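/- Let $\omega$ be a non-principal ultrafilter on $\mathbb N$, and let $(X_i,d_i,\mathfrak m_i,p_i)_{i\in\mathbb N}$ be pointed Polish metric measure spaces: $(X_i,d_i)$ is a complete separable metric space, $\mathfrak m_i\ge 0$ is a Borel measure on $X_i$, and $p_i\in X_i$. Let $X_\omega$ be the set of sequences $(x_i)\in\prod_i X_i$ with $\lim_{i\to\omega}d_i(x_i,p_i)<\infty$, modulo $\lim_{i\to\omega}d_i(x_i,y_i)=0$, with the metric $d_\omega([[x_i]],[[y_i]])=\lim_{i\to\omega}d_i(x_i,y_i)$ and the base point $p_\omega=[[p_i]]$. Let $\mathfrak m_\omega$ be the ultralimit measure, defined on the $\sigma$-algebra generated by the open balls of $X_\omega$: it is the push-forward, under $(x_i)\mapsto[[x_i]]$, of the Carathéodory extension of the set function which assigns to the set of sequences as above with $x_i\in A_i$ for $\omega$-a.e. $i$ (with $A_i\subset X_i$ Borel) the value $\lim_{R\to\infty}\lim_{i\to\omega}\mathfrak m_i(A_i\cap B(p_i,R))$. Put $\mathrm{spt}(\mathfrak m_\omega)=\{x\in X_\omega:\mathfrak m_\omega(B(x,r))>0\ \forall r>0\}$.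 Assume that the sequence is asymptotically boundedly $\mathfrak m_\omega$-totally bounded, that is: (a) there is $\eta:(0,\infty)\to(0,\infty)$ such that for every $R>0$ one has $\mathfrak m_i(B(p_i,R))\le\eta(R)$ for $\omega$-a.e. $i$; and (b) for all $R,r,\varepsilon>0$ there are $M\in\mathbb N$ and points $x^i_1,\dots,x^i_M\in X_i$ with $\lim_{i\to\omega}\mathfrak m_i\big(\bar B(p_i,R)\setminus\bigcup_{n=1}^M B(x^i_n,r)\big)\le\varepsilon$. Let $Y=\mathrm{spt}(\mathfrak m_\omega)\cup\{p_\omega\}$ (so $Y=\mathrm{spt}(\mathfrak m_\omega)$ if $p_\omega\in\mathrm{spt}(\mathfrak m_\omega)$), with the restrictions of $d_\omega$ and $\mathfrak m_\omega$. Then $(Y,d_\omega,\mathfrak m_\omega,p_\omega)$ is a pointed Polish metric measure space (complete, separable, $\mathfrak m_\omega$ a Borel measure on $Y$), and there are $\tilde R_k,\tilde\varepsilon_k\in\mathbb R$ and maps $\psi_k:B(p_k,\tilde R_k)\to Y$, $k\in\mathbb N$, such that $\lim_{k\to\omega}\tilde R_k=\infty$, $\lim_{k\to\omega}\tilde\varepsilon_k=0$,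 for $\omega$-a.e. $k$ the map $\psi_k$ is a weak $(\tilde R_k,\tilde\varepsilon_k)$-approximation, and $$\lim_{k\to\omega}\int f\,d(\psi_k)_*\mathfrak m_k=\int_Y f\,d\mathfrak m_\omega$$ for every bounded continuous $f:Y\to\mathbb R$ with bounded support (the integrals exist for $\omega$-a.e. $k$, and so does the one on the right). Here $(\psi_k)_*\mathfrak m_k(E)=\mathfrak m_k(\psi_k^{-1}(E))$ with $\psi_k^{-1}(E)\subset B(p_k,\tilde R_k)$. Moreover a subsequence converges in the weak pointed measured Gromov–Hausdorff sense: there are indices $k_0<k_1<\cdots$, numbers $R_j\nearrow\infty$ and $\varepsilon_j\searrow0$, and, for every $j$, a weak $(R_j,\varepsilon_j)$-approximation $\phi_j:B(p_{k_j},R_j)\to Y$ such that $\lim_{j\to\infty}\int f\,d(\phi_j)_*\mathfrak m_{k_j}=\int_Y f\,d\mathfrak m_\omega$ for every $f$ as above (the integrals exist for all large $j$). A Borel map $\psi:B(p_X,R)\to Y$, from a ball of a pointed Polish metric measure space $(X,d_X,\mathfrak m_X,p_X)$ to $(Y,d_Y,\mathfrak m_Y,p_Y)$, is a weak $(R,\varepsilon)$-approximation,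 where $0<\varepsilon<R$, if $\psi(p_X)=p_Y$ and there is a Borel set $\tilde X\subset B(p_X,R)$ containing $p_X$ with $|d_X(x,y)-d_Y(\psi(x),\psi(y))|\le\varepsilon$ for all $x,y\in\tilde X$, $\mathfrak m_X(B(p_X,R)\setminus\tilde X)\le\varepsilon$ and $\mathfrak m_Y(B(p_Y,R-\varepsilon)\setminus\psi(\tilde X)^\varepsilon)\le\varepsilon$, where $A^\varepsilon$ is the open $\varepsilon$-neighbourhood of $A$. -/

import Mathlib

open MeasureTheory Filter Topology Set
open scoped ENNReal NNReal

noncomputable section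

namespace UltraMMS

universe u v

/- Ultralimits of pointed metric spaces. -/

section UltraLimit

variable {X : ℕ → Type u} [∀ i, MetricSpace (X i)]

/-- Sequences `(x_i)` with `x_i ∈ X_i` and `lim_{i → ω} d_i(x_i, p_i) < ∞`. Since the spaces are
pointed, partial sequences indexed by a set of `ω` need not be considered. Sequences that agree
`ω`-almost everywhere are identified later, together with those at distance `0`. -/
structure BddSeq (ω : Ultrafilter ℕ) (p : ∀ i, X i) where
  seq : ∀ i, X i
  bdd : ∃ C : ℝ, ∀ᶠ i in (ω : Filter ℕ), dist (seq i) (p i) ≤ C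

variable {ω : Ultrafilter ℕ} {p : ∀ i, X i}

/-- `d_ω(x, y) = lim_{i → ω} d_i(x_i, y_i)`. -/
instance BddSeq.instDist : Dist (BddSeq ω p) where
  dist x y := limUnder (ω : Filter ℕ) fun i => dist (x.seq i) (y.seq i)

theorem BddSeq.tendsto_dist (x y : BddSeq ω p) :
    Tendsto (fun i => dist (x.seq i) (y.seq i)) (ω : Filter ℕ) (𝓝 (dist x y)) := by
  obtain ⟨C, hC⟩ := x.bdd
  obtain ⟨D, hD⟩ := y.bdd
  have h : ∀ᶠ i in (ω : Filter ℕ), dist (x.seq i) (y.seq i) ∈ Icc (0 : ℝ) (C + D) := by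
    filter_upwards [hC, hD] with i h1 h2
    exact ⟨dist_nonneg, (dist_triangle_right _ _ (p i)).trans (add_le_add h1 h2)⟩
  obtain ⟨a, -, ha⟩ := (isCompact_Icc (a := (0 : ℝ)) (b := C + D)).ultrafilter_le_nhds
    (ω.map fun i => dist (x.seq i) (y.seq i)) (le_principal_iff.2 h)
  exact tendsto_nhds_limUnder ⟨a, ha⟩

instance BddSeq.instPseudoMetricSpace : PseudoMetricSpace (BddSeq ω p) where
  dist_self x := tendsto_nhds_unique (x.tendsto_dist x) (by simp)
  dist_comm x y := tendsto_nhds_unique (x.tendsto_dist y)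
    (by simpa only [dist_comm] using y.tendsto_dist x)
  dist_triangle x y z := le_of_tendsto_of_tendsto' (x.tendsto_dist z)
    ((x.tendsto_dist y).add (y.tendsto_dist z)) fun i => dist_triangle _ _ _

variable (ω p)

/-- The set `X_ω` underlying the ultralimit of the pointed metric spaces `(X_i, d_i, p_i)`. -/
def UltraLimit : Type u := SeparationQuotient (BddSeq ω p)

instance UltraLimit.instMetricSpace : MetricSpace (UltraLimit ω p) :=
  inferInstanceAs (MetricSpace (SeparationQuotient (BddSeq ω p)))

/-- The ball `σ`-algebra, generated by the open balls of `X_ω`. -/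
instance UltraLimit.instMeasurableSpace : MeasurableSpace (UltraLimit ω p) :=
  MeasurableSpace.generateFrom
    {s | ∃ (x : UltraLimit ω p) (r : ℝ), 0 < r ∧ s = Metric.ball x r}

/-- The projection from bounded sequences to `X_ω`. -/
def UltraLimit.mk (x : BddSeq ω p) : UltraLimit ω p := SeparationQuotient.mk x

/-- The base point `p_ω` of the ultralimit. -/
def UltraLimit.base : UltraLimit ω p :=
  UltraLimit.mk ω p ⟨p, 0, Eventually.of_forall fun i => (dist_self (p i)).le⟩

/- The ultralimit measure. -/

/-- The part inside the bounded sequences of the ultraproduct of the sets `A_i`. -/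
def internal (A : ∀ i, Set (X i)) : Set (BddSeq ω p) :=
  {x | ∀ᶠ i in (ω : Filter ℕ), x.seq i ∈ A i}

variable [∀ i, MeasurableSpace (X i)]

/-- The `σ`-algebra generated by the ultraproducts of measurable sets. -/
instance BddSeq.instMeasurableSpace : MeasurableSpace (BddSeq ω p) :=
  MeasurableSpace.generateFrom
    {s | ∃ A : ∀ i, Set (X i), (∀ i, MeasurableSet (A i)) ∧ s = internal ω p A}

variable (m : ∀ i, Measure (X i))

/-- `lim_{R → ∞} lim_{i → ω} m_i(A_i ∩ B(p_i, R))`; the limit in `R` is monotone. -/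
def content (A : ∀ i, Set (X i)) : ℝ≥0∞ :=
  ⨆ R : ℕ, limUnder (ω : Filter ℕ) fun i => m i (A i ∩ Metric.ball (p i) R)

/-- The set function sending the ultraproduct of measurable sets `A_i` (inside the bounded
sequences) to `content A`, and every other set to `∞`. -/
def premeasure (s : Set (BddSeq ω p)) : ℝ≥0∞ :=
  ⨅ (A : ∀ i, Set (X i)) (_ : ∀ i, MeasurableSet (A i)) (_ : s = internal ω p A),
    content ω p m A

theorem tendsto_limUnder_ennreal (f : ℕ → ℝ≥0∞) :
    Tendsto f (ω : Filter ℕ) (𝓝 (limUnder (ω : Filter ℕ) f)) := by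
  obtain ⟨a, -, ha⟩ := isCompact_univ.ultrafilter_le_nhds (ω.map f) (by simp)
  exact tendsto_nhds_limUnder ⟨a, ha⟩

theorem premeasure_empty : premeasure ω p m ∅ = 0 := by
  refine le_antisymm ?_ zero_le
  refine (iInf_le _ fun _ => ∅).trans <| (iInf_le _ fun _ => MeasurableSet.empty).trans <|
    (iInf_le _ ?_).trans ?_
  · ext x
    simp only [internal, mem_empty_iff_false, eventually_false_iff_eq_bot, mem_ofPred_eq]
    exact iff_of_false not_false ω.neBot.ne
  · simp only [content, empty_inter, measure_empty]
    refine iSup_le fun _ => (tendsto_nhds_unique (tendsto_limUnder_ennreal ω _)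
      tendsto_const_nhds).le

theorem content_inter_add_diff (T A : ∀ i, Set (X i)) (hA : ∀ i, MeasurableSet (A i)) :
    content ω p m (fun i => T i ∩ A i) + content ω p m (fun i => T i \ A i) =
      content ω p m T := by
  have mono (S : ∀ i, Set (X i)) :
      Monotone fun R : ℕ => limUnder (ω : Filter ℕ) fun i => m i (S i ∩ Metric.ball (p i) R) := by
    intro R R' h
    refine le_of_tendsto_of_tendsto' (tendsto_limUnder_ennreal ω _)
      (tendsto_limUnder_ennreal ω _) fun i => measure_mono ?_
    exact inter_subset_inter_right _ (Metric.ball_subset_ball (by exact_mod_cast h))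
  unfold content
  rw [ENNReal.iSup_add_iSup_of_monotone (mono _) (mono _)]
  congr 1
  funext R
  refine tendsto_nhds_unique
    ((tendsto_limUnder_ennreal ω _).add (tendsto_limUnder_ennreal ω _)) ?_
  refine (tendsto_limUnder_ennreal ω _).congr fun i => ?_
  rw [← measure_inter_add_sdiff (T i ∩ Metric.ball (p i) R) (hA i), inter_right_comm]
  congr 2
  ext x
  simp only [mem_inter_iff, Set.mem_sdiff]
  tauto

/-- The outer measure induced by `premeasure`. -/
def outer : OuterMeasure (BddSeq ω p) :=
  OuterMeasure.ofFunction (premeasure ω p m) (premeasure_empty ω p m)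

theorem le_caratheodory : BddSeq.instMeasurableSpace ω p ≤ (outer ω p m).caratheodory := by
  refine MeasurableSpace.generateFrom_le ?_
  rintro _ ⟨A, hA, rfl⟩
  refine OuterMeasure.ofFunction_caratheodory fun t => ?_
  rw [premeasure.eq_def ω p m t]
  refine le_iInf fun T => le_iInf fun hT => le_iInf fun ht => ?_
  rw [← content_inter_add_diff ω p m T A hA]
  refine add_le_add ?_ ?_
  · refine (iInf_le _ fun i => T i ∩ A i).trans <|
      (iInf_le _ fun i => (hT i).inter (hA i)).trans (iInf_le _ ?_)
    ext x
    simp [ht, internal, eventually_and]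
  · refine (iInf_le _ fun i => T i \ A i).trans <|
      (iInf_le _ fun i => (hT i).diff (hA i)).trans (iInf_le _ ?_)
    ext x
    have hn : (∀ᶠ i in (ω : Filter ℕ), x.seq i ∉ A i) ↔
        ¬ ∀ᶠ i in (ω : Filter ℕ), x.seq i ∈ A i := Ultrafilter.eventually_not
    rw [ht]
    exact ((eventually_and.trans (and_congr_right' hn))).symm

/-- The measure on the bounded sequences, extending the set function
`A ↦ lim_{R → ∞} lim_{i → ω} m_i(A_i ∩ B(p_i, R))` on ultraproducts of measurable sets. -/
def loebMeasure : Measure (BddSeq ω p) := (outer ω p m).toMeasure (le_caratheodory ω p m)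

/-- The ultralimit measure `m_ω`, a measure on the ball `σ`-algebra of `X_ω`. -/
def ultraMeasure : Measure (UltraLimit ω p) := (loebMeasure ω p m).map (UltraLimit.mk ω p)

/-- The projection is measurable, so that `ultraMeasure` is a genuine push-forward. -/
theorem measurable_mk [∀ i, BorelSpace (X i)] : Measurable (UltraLimit.mk ω p) := by
  refine measurable_generateFrom ?_
  rintro _ ⟨y, r, -, rfl⟩
  obtain ⟨y, rfl⟩ : ∃ y', UltraLimit.mk ω p y' = y := SeparationQuotient.surjective_mk y
  have key : UltraLimit.mk ω p ⁻¹' Metric.ball (UltraLimit.mk ω p y) r =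
      ⋃ n : ℕ, internal ω p fun i => Metric.ball (y.seq i) (r - 1 / ((n : ℝ) + 1)) := by
    ext x
    have hd : dist (UltraLimit.mk ω p x) (UltraLimit.mk ω p y) = dist x y :=
      SeparationQuotient.dist_mk x y
    simp only [mem_preimage, Metric.mem_ball, hd, mem_iUnion, internal, mem_ofPred_eq]
    constructor
    · intro h
      obtain ⟨n, hn⟩ := exists_nat_one_div_lt (sub_pos.2 h)
      exact ⟨n, (x.tendsto_dist y).eventually_lt_const (by linarith)⟩
    · rintro ⟨n, hn⟩
      have h1 : dist x y ≤ r - 1 / ((n : ℝ) + 1) :=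
        le_of_tendsto (x.tendsto_dist y) (hn.mono fun i hi => hi.le)
      have h2 : (0 : ℝ) < 1 / ((n : ℝ) + 1) := by positivity
      linarith
  rw [key]
  exact MeasurableSet.iUnion fun n => MeasurableSpace.measurableSet_generateFrom
    ⟨_, fun i => measurableSet_ball, rfl⟩

end UltraLimit

/-- The support of a measure defined on (at least) the ball `σ`-algebra. -/
def spt {Z : Type*} [MetricSpace Z] [MeasurableSpace Z] (μ : Measure Z) : Set Z :=
  {x | ∀ r : ℝ, 0 < r → 0 < μ (Metric.ball x r)}

section Limit

variable {X : ℕ → Type u} [∀ i, MetricSpace (X i)] [∀ i, MeasurableSpace (X i)]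
  (ω : Ultrafilter ℕ) (m : ∀ i, Measure (X i)) (p : ∀ i, X i)

/-- `spt(m_ω) ∪ {p_ω}`, which is just `spt(m_ω)` when `p_ω ∈ spt(m_ω)`. The point `p_ω` is added
since a base point is needed; otherwise it is `m_ω`-negligible. -/
def limitSet : Set (UltraLimit ω p) :=
  insert (UltraLimit.base ω p) (spt (ultraMeasure ω p m))

/-- The measure `m_ω` on `spt(m_ω) ∪ {p_ω}`. -/
def limitMeasure : Measure (limitSet ω m p) :=
  (ultraMeasure ω p m).comap Subtype.val

/-- The base point `p_ω` of `spt(m_ω) ∪ {p_ω}`. -/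
def limitBase : limitSet ω m p := ⟨UltraLimit.base ω p, mem_insert _ _⟩

/-- `ω`-uniform bounded finiteness. -/
def IsUniformlyBoundedlyFinite : Prop :=
  ∃ η : ℝ → ℝ≥0, ∀ R : ℝ, 0 < R →
    ∀ᶠ i in (ω : Filter ℕ), m i (Metric.ball (p i) R) ≤ η R

/-- Asymptotic bounded `m_ω`-total boundedness. -/
def IsAsymptoticallyBoundedlyTotallyBounded : Prop :=
  IsUniformlyBoundedlyFinite ω m p ∧
  ∀ R r ε : ℝ, 0 < R → 0 < r → 0 < ε →
    ∃ (M : ℕ) (x : ∀ i, Fin M → X i),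
      limUnder (ω : Filter ℕ)
        (fun i => m i (Metric.closedBall (p i) R \ ⋃ n, Metric.ball (x i n) r)) ≤
          ENNReal.ofReal ε

end Limit

/-- Weak `(R, ε)`-approximations `ψ : B(p, R) → Y` from `(X, d_X, μ, p)` to `(Y, d_Y, ν, q)`. -/
structure IsWeakApproximation {X : Type u} {Y : Type v} [MetricSpace X] [MeasurableSpace X]
    [MetricSpace Y] [MeasurableSpace Y] (μ : Measure X) (ν : Measure Y) (p : X) (q : Y)
    (R ε : ℝ) (ψ : Metric.ball p R → Y) : Prop where
  eps_pos : 0 < ε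
  eps_lt : ε < R
  measurable : Measurable ψ
  map_base : ∀ x : Metric.ball p R, (x : X) = p → ψ x = q
  exists_set : ∃ T : Set (Metric.ball p R), MeasurableSet T ∧ p ∈ Subtype.val '' T ∧
    (∀ x ∈ T, ∀ y ∈ T, dist x y - ε ≤ dist (ψ x) (ψ y) ∧ dist (ψ x) (ψ y) ≤ dist x y + ε) ∧
    μ (Metric.ball p R \ Subtype.val '' T) ≤ ENNReal.ofReal ε ∧
    ν (Metric.ball q (R - ε) \ Metric.thickening ε (ψ '' T)) ≤ ENNReal.ofReal ε

/-- The push-forward of `μ` under a map that is defined on the ball `B(p, R)` only. -/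
def pushBall {X : Type u} {Y : Type v} [MetricSpace X] [MeasurableSpace X] [MeasurableSpace Y]
    (μ : Measure X) (p : X) (R : ℝ) (ψ : Metric.ball p R → Y) : Measure Y :=
  (μ.comap (Subtype.val : Metric.ball p R → X)).map ψ

/-- Weak convergence of measures along a filter in duality with `C_bbs(Y)`, the bounded
continuous functions with bounded support. All integrals are required to exist. -/
def WeaklyTendsto {Y : Type v} [MetricSpace Y] [MeasurableSpace Y] (l : Filter ℕ)
    (μ : ℕ → Measure Y) (ν : Measure Y) : Prop :=
  ∀ f : Y → ℝ, Continuous f → (∃ C : ℝ, ∀ y, |f y| ≤ C) → Bornology.IsBounded (tsupport f) →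
    Integrable f ν ∧ (∀ᶠ k in l, Integrable f (μ k)) ∧
      Tendsto (fun k => ∫ y, f y ∂(μ k)) l (𝓝 (∫ y, f y ∂ν))

section Convergence

variable {X : ℕ → Type u} [∀ i, MetricSpace (X i)] [∀ i, MeasurableSpace (X i)]
  {Y : Type v} [MetricSpace Y] [MeasurableSpace Y]

/-- Weak pointed measured Gromov-Hausdorff convergence along an ultrafilter. -/
def WPMGHConvergesAlong (ω : Ultrafilter ℕ) (m : ∀ i, Measure (X i)) (p : ∀ i, X i)
    (ν : Measure Y) (q : Y) : Prop :=
  ∃ (R ε : ℕ → ℝ) (ψ : ∀ k, Metric.ball (p k) (R k) → Y),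
    (∀ᶠ k in (ω : Filter ℕ), IsWeakApproximation (m k) ν (p k) q (R k) (ε k) (ψ k)) ∧
    Tendsto R (ω : Filter ℕ) atTop ∧ Tendsto ε (ω : Filter ℕ) (𝓝 0) ∧
    WeaklyTendsto (ω : Filter ℕ) (fun k => pushBall (m k) (p k) (R k) (ψ k)) ν

/-- Weak pointed measured Gromov-Hausdorff convergence of a sequence. -/
def WPMGHConverges (m : ∀ i, Measure (X i)) (p : ∀ i, X i) (ν : Measure Y) (q : Y) : Prop :=
  ∃ (R ε : ℕ → ℝ) (ψ : ∀ k, Metric.ball (p k) (R k) → Y),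
    (∀ k, IsWeakApproximation (m k) ν (p k) q (R k) (ε k) (ψ k)) ∧
    (Monotone R ∧ Tendsto R atTop atTop) ∧ (Antitone ε ∧ Tendsto ε atTop (𝓝 0)) ∧
    WeaklyTendsto atTop (fun k => pushBall (m k) (p k) (R k) (ψ k)) ν

end Convergence

end UltraMMS

end

namespace UltraMMS

universe u v

/-! `ultraMeasure` is the image of a Loeb measure on bounded sequences. By countable saturation, a
countable internal cover of an internal set inside a ball is already finite at ω-almost every index.
Hence the content is countably subadditive, and the Loeb measure of such a set is the ω-limit of the
measures of its components (`tendsto_measure_of_subset_ball`).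

The space X_ω need not be separable, so Y needs two separate arguments. Bounded finiteness makes the
support separable, because a ball of finite measure contains only countably many disjoint balls of
positive measure (`isSeparable_spt`). Total boundedness makes the complement of Y negligible
(`ultraMeasure_compl_limitSet`).

For the approximations, take representatives y_j of a dense sequence of Y, starting with the base
point, and send a point of X_k to the class of the first y_j whose k-th term is r-close to it. Up to
small measure finitely many j suffice. So only finitely many distances and masses have to be near
their limits, which holds for ω-almost every k (`exists_approximations`). The same rule on bounded
sequences gives maps Ψ into Y whose integrals are close to those of the approximations, uniformly
over |f| ≤ C. As r → 0 with summable errors, Borel–Cantelli and dominated convergence identify the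
limit (`tendsto_setIntegral_approximations`). A level growing with k yields convergence along ω; one
index per level yields the subsequence. -/

theorem le_atTop_of_singleton_notMem {ω : Ultrafilter ℕ} (hω : ∀ n : ℕ, ({n} : Set ℕ) ∉ ω) :
    (ω : Filter ℕ) ≤ atTop := by
  rw [← Nat.cofinite_eq_atTop]
  rcases ω.le_cofinite_or_eq_pure with h | ⟨n, rfl⟩
  · exact h
  · exact absurd (by simp) (hω n)

/-- `N i` is the largest `n ≤ i` such that `P 0, …, P n` all hold at `i`. Capping the search at `i`
does no harm because `l ≤ atTop`. -/
theorem exists_tendsto_diagonal {l : Filter ℕ} (hl : l ≤ atTop) {P : ℕ → ℕ → Prop}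
    (hP : ∀ n, ∀ᶠ i in l, P n i) :
    ∃ N : ℕ → ℕ, Tendsto N l atTop ∧ ∀ᶠ i in l, P (N i) i := by
  classical
  let Q : ℕ → ℕ → Prop := fun i n => ∀ j ≤ n, P j i
  have hQ (n : ℕ) : ∀ᶠ i in l, Q i n :=
    (eventually_all_finite (Set.finite_Iic n)).2 fun j _ => hP j
  refine ⟨fun i => Nat.findGreatest (Q i) i, ?_, ?_⟩
  · refine tendsto_atTop.2 fun n => ?_
    filter_upwards [hQ n, hl (eventually_ge_atTop n)] with i hi hn
    exact Nat.le_findGreatest hn hi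
  · filter_upwards [hQ 0] with i hi
    exact Nat.findGreatest_spec (P := Q i) (Nat.zero_le i) hi _ le_rfl

/-! ### Completeness, saturation, and the Loeb measure of internal sets. -/

section UltraLimit

variable {X : ℕ → Type u} [∀ i, MetricSpace (X i)] {ω : Ultrafilter ℕ} {p : ∀ i, X i}

theorem UltraLimit.mk_surjective : Function.Surjective (UltraLimit.mk ω p) :=
  SeparationQuotient.surjective_mk

theorem UltraLimit.dist_mk (x y : BddSeq ω p) :
    dist (UltraLimit.mk ω p x) (UltraLimit.mk ω p y) = dist x y :=
  SeparationQuotient.dist_mk x y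

/-- The constant sequence of base points. -/
noncomputable def BddSeq.base (ω : Ultrafilter ℕ) (p : ∀ i, X i) : BddSeq ω p :=
  ⟨p, 0, Eventually.of_forall fun i => (dist_self (p i)).le⟩

theorem UltraLimit.mk_base : UltraLimit.mk ω p (BddSeq.base ω p) = UltraLimit.base ω p := rfl

/-- The limit is the diagonal sequence whose `i`-th term comes from representative number `N i`,
where `N` grows slowly enough for the Cauchy estimates to hold at index `i`. -/
theorem UltraLimit.completeSpace (hω : (ω : Filter ℕ) ≤ atTop) :
    CompleteSpace (UltraLimit ω p) := by
  refine Metric.complete_of_convergent_controlled_sequences (fun n => (1 / 2 : ℝ) ^ n)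
    (fun n => by positivity) fun u hu => ?_
  choose x hx using fun n => UltraLimit.mk_surjective (u n)
  have hE (n : ℕ) : ∀ᶠ i in (ω : Filter ℕ),
      ∀ k ≤ n, dist ((x k).seq i) ((x n).seq i) < (1 / 2 : ℝ) ^ k := by
    refine (eventually_all_finite (Set.finite_Iic n)).2 fun k hk => ?_
    have := hu k k n le_rfl hk
    rw [← hx, ← hx, UltraLimit.dist_mk] at this
    exact ((x k).tendsto_dist (x n)).eventually_lt_const this
  obtain ⟨N, hN, hNE⟩ := exists_tendsto_diagonal hω hE
  obtain ⟨C, hC⟩ := (x 0).bdd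
  let y : BddSeq ω p := ⟨fun i => (x (N i)).seq i, C + 1, by
    filter_upwards [hNE, hC] with i h1 h2
    have := h1 0 (Nat.zero_le _)
    rw [dist_comm, pow_zero] at this
    linarith [dist_triangle ((x (N i)).seq i) ((x 0).seq i) (p i)]⟩
  refine ⟨UltraLimit.mk ω p y, ?_⟩
  refine tendsto_iff_dist_tendsto_zero.2 (squeeze_zero (fun _ => dist_nonneg) (fun n => ?_)
    (tendsto_pow_atTop_nhds_zero_of_lt_one (by norm_num) (by norm_num : (1 / 2 : ℝ) < 1)))
  rw [← hx, UltraLimit.dist_mk]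
  refine le_of_tendsto ((x n).tendsto_dist y) ?_
  filter_upwards [hNE, hN.eventually_ge_atTop n] with i h1 h2
  exact (h1 n h2).le

theorem internal_mono {A B : ∀ i, Set (X i)} (h : ∀ i, A i ⊆ B i) :
    internal ω p A ⊆ internal ω p B :=
  fun _ hx => Eventually.mono hx fun i hi => h i hi

/-- Countable saturation of the internal sets. -/
theorem exists_subset_biUnion_of_internal_subset_iUnion (hω : (ω : Filter ℕ) ≤ atTop)
    {A : ∀ i, Set (X i)} {B : ℕ → ∀ i, Set (X i)} {R : ℝ}
    (hA : ∀ i, A i ⊆ Metric.ball (p i) R)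
    (h : internal ω p A ⊆ ⋃ n, internal ω p (B n)) :
    ∃ n, ∀ᶠ i in (ω : Filter ℕ), A i ⊆ ⋃ l ∈ Finset.range n, B l i := by
  by_contra! hn
  have hE (n : ℕ) : ∀ᶠ i in (ω : Filter ℕ), ∃ x ∈ A i, ∀ l < n, x ∉ B l i := by
    filter_upwards [hn n] with i hi
    obtain ⟨x, hx, hxB⟩ := not_subset.1 hi
    exact ⟨x, hx, fun l hl hl' => hxB (mem_biUnion (Finset.mem_coe.2 (Finset.mem_range.2 hl)) hl')⟩
  -- Along the diagonal, points avoiding finitely many `B l i` form one sequence in `A` that avoids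
  -- every `B l`; it is bounded because `A i` lies in a ball of fixed radius.
  obtain ⟨N, hN, hNE⟩ := exists_tendsto_diagonal hω hE
  have : ∀ i, ∃ x : X i, (∃ x ∈ A i, ∀ l < N i, x ∉ B l i) → x ∈ A i ∧ ∀ l < N i, x ∉ B l i := by
    intro i
    by_cases hi : ∃ x ∈ A i, ∀ l < N i, x ∉ B l i
    · obtain ⟨x, hx⟩ := hi
      exact ⟨x, fun _ => hx⟩
    · exact ⟨p i, fun h => absurd h hi⟩
  choose x hx using this
  let y : BddSeq ω p := ⟨x, R, hNE.mono fun i hi => (hA i (hx i hi).1).le⟩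
  have hy : y ∈ internal ω p A := hNE.mono fun i hi => (hx i hi).1
  obtain ⟨l, hl⟩ := mem_iUnion.1 (h hy)
  obtain ⟨i, h1, h2, h3⟩ := (hNE.and ((hN.eventually_gt_atTop l).and hl)).exists
  exact (hx i h1).2 l h2 h3

section Measure

variable [∀ i, MeasurableSpace (X i)] (m : ∀ i, Measure (X i))

theorem measurableSet_internal {A : ∀ i, Set (X i)} (hA : ∀ i, MeasurableSet (A i)) :
    MeasurableSet (internal ω p A) :=
  MeasurableSpace.measurableSet_generateFrom ⟨A, hA, rfl⟩

/-- Inside each ball saturation reduces the cover to a finite one, and finite subadditivity of the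
`m i` passes to the ω-limit. -/
theorem content_le_tsum_of_internal_subset_iUnion (hω : (ω : Filter ℕ) ≤ atTop)
    {A : ∀ i, Set (X i)} {B : ℕ → ∀ i, Set (X i)}
    (h : internal ω p A ⊆ ⋃ n, internal ω p (B n)) :
    content ω p m A ≤ ∑' n, content ω p m (B n) := by
  refine iSup_le fun R => ?_
  obtain ⟨n, hn⟩ := exists_subset_biUnion_of_internal_subset_iUnion hω
    (A := fun i => A i ∩ Metric.ball (p i) R) (R := R) (fun i => inter_subset_right)
    ((internal_mono fun i => inter_subset_left).trans h)
  refine le_trans ?_ (ENNReal.sum_le_tsum (Finset.range n))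
  refine le_trans ?_ (Finset.sum_le_sum fun l _ => le_iSup (fun R : ℕ => limUnder (ω : Filter ℕ)
    fun i => m i (B l i ∩ Metric.ball (p i) R)) R)
  refine le_of_tendsto_of_tendsto (tendsto_limUnder_ennreal ω _)
    (tendsto_finsetSum _ fun l _ => tendsto_limUnder_ennreal ω _) ?_
  filter_upwards [hn] with i hi
  refine (measure_mono ?_).trans (measure_biUnion_finset_le (Finset.range n)
    fun l => B l i ∩ Metric.ball (p i) R)
  intro x hx
  obtain ⟨l, hl, hxl⟩ := mem_iUnion₂.1 (hi hx)
  exact mem_iUnion₂.2 ⟨l, hl, hxl, hx.2⟩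

theorem content_mono_of_internal_subset (hω : (ω : Filter ℕ) ≤ atTop)
    {A B : ∀ i, Set (X i)} (h : internal ω p A ⊆ internal ω p B) :
    content ω p m A ≤ content ω p m B := by
  refine iSup_mono fun R => ?_
  obtain ⟨n, hn⟩ := exists_subset_biUnion_of_internal_subset_iUnion hω
    (A := fun i => A i ∩ Metric.ball (p i) R) (R := R) (B := fun _ => B)
    (fun i => inter_subset_right)
    ((internal_mono fun i => inter_subset_left).trans (h.trans (subset_iUnion_of_subset 0 le_rfl)))
  refine le_of_tendsto_of_tendsto (tendsto_limUnder_ennreal ω _)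
    (tendsto_limUnder_ennreal ω _) ?_
  filter_upwards [hn] with i hi
  refine measure_mono fun x hx => ⟨?_, hx.2⟩
  obtain ⟨l, -, hl⟩ := mem_iUnion₂.1 (hi hx)
  exact hl

theorem loebMeasure_internal_eq_content (hω : (ω : Filter ℕ) ≤ atTop)
    {A : ∀ i, Set (X i)} (hA : ∀ i, MeasurableSet (A i)) :
    loebMeasure ω p m (internal ω p A) = content ω p m A := by
  rw [loebMeasure, toMeasure_apply _ _ (measurableSet_internal hA)]
  refine le_antisymm ((OuterMeasure.ofFunction_le _).trans
    ((iInf_le _ A).trans ((iInf_le _ hA).trans (iInf_le _ rfl)))) ?_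
  rw [outer, OuterMeasure.ofFunction_apply]
  refine le_iInf₂ fun s hs => ?_
  by_cases hfin : ∀ n, ∃ B : ∀ i, Set (X i), s n = internal ω p B
  · choose B hB using hfin
    refine (content_le_tsum_of_internal_subset_iUnion m hω (B := B) ?_).trans
      (ENNReal.tsum_le_tsum fun n => le_iInf fun C => le_iInf fun _ => le_iInf fun hC => ?_)
    · simpa only [← hB] using hs
    · exact content_mono_of_internal_subset m hω (by rw [← hB, ← hC])
  -- A cover by sets not all internal costs `∞`, since `premeasure` is then an infimum over an empty
  -- family.
  · push Not at hfin
    obtain ⟨n, hn⟩ := hfin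
    refine le_top.trans (le_trans ?_ (ENNReal.le_tsum n))
    exact le_iInf fun B => le_iInf fun _ => le_iInf fun hB => absurd hB (hn B)

/-- For sets in a common ball the supremum over radii in `content` is attained, which leaves a plain
ω-limit. -/
theorem tendsto_measure_of_subset_ball (hω : (ω : Filter ℕ) ≤ atTop)
    {A : ∀ i, Set (X i)} (hA : ∀ i, MeasurableSet (A i)) {R : ℝ}
    (hR : ∀ i, A i ⊆ Metric.ball (p i) R) :
    Tendsto (fun i => m i (A i)) (ω : Filter ℕ) (𝓝 (loebMeasure ω p m (internal ω p A))) := by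
  rw [loebMeasure_internal_eq_content m hω hA]
  convert tendsto_limUnder_ennreal ω fun i => m i (A i) using 2
  obtain ⟨N, hN⟩ := exists_nat_ge R
  refine le_antisymm (iSup_le fun R' => ?_) ?_
  · exact le_of_tendsto_of_tendsto' (tendsto_limUnder_ennreal ω _)
      (tendsto_limUnder_ennreal ω _) fun i => measure_mono inter_subset_left
  · refine le_trans (le_of_eq ?_) (le_iSup _ N)
    congr 1
    funext i
    rw [inter_eq_left.2 ((hR i).trans (Metric.ball_subset_ball hN))]

end Measure

end UltraLimit

/-! ### Borel structure on separable subsets of the ultralimit. -/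

section BallSigmaAlgebra

variable {X : ℕ → Type u} [∀ i, MetricSpace (X i)] {ω : Ultrafilter ℕ} {p : ∀ i, X i}

theorem UltraLimit.measurableSet_ball (x : UltraLimit ω p) (r : ℝ) :
    MeasurableSet (Metric.ball x r) := by
  rcases le_or_gt r 0 with h | h
  · rw [Metric.ball_eq_empty.2 h]
    exact MeasurableSet.empty
  · exact MeasurableSpace.measurableSet_generateFrom ⟨x, r, h, rfl⟩

theorem UltraLimit.measurableSet_closedBall (x : UltraLimit ω p) (r : ℝ) :
    MeasurableSet (Metric.closedBall x r) := by
  have : Metric.closedBall x r = ⋂ n : ℕ, Metric.ball x (r + 1 / ((n : ℝ) + 1)) := by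
    ext y
    simp only [Metric.mem_closedBall, mem_iInter, Metric.mem_ball]
    refine ⟨fun h n => h.trans_lt (lt_add_of_pos_right _ (by positivity)), fun h => ?_⟩
    refine le_of_forall_pos_lt_add fun ε hε => ?_
    obtain ⟨n, hn⟩ := exists_nat_one_div_lt hε
    exact (h n).trans (by linarith)
  rw [this]
  exact MeasurableSet.iInter fun n => UltraLimit.measurableSet_ball _ _

theorem UltraLimit.measurableSet_closure_of_countable {D : Set (UltraLimit ω p)}
    (hD : D.Countable) : MeasurableSet (closure D) := by
  have : closure D = ⋂ n : ℕ, ⋃ x ∈ D, Metric.ball x (1 / ((n : ℝ) + 1)) := by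
    ext y
    simp only [Metric.mem_closure_iff, mem_iInter, mem_iUnion, Metric.mem_ball, exists_prop]
    refine ⟨fun h n => h _ (by positivity), fun h ε hε => ?_⟩
    obtain ⟨n, hn⟩ := exists_nat_one_div_lt hε
    obtain ⟨x, hx, hxy⟩ := h n
    exact ⟨x, hx, hxy.trans hn⟩
  rw [this]
  exact MeasurableSet.iInter fun n => MeasurableSet.biUnion hD fun x _ =>
    UltraLimit.measurableSet_ball _ _

theorem UltraLimit.measurableSet_of_isClosed_of_isSeparable {F : Set (UltraLimit ω p)}
    (hF : IsClosed F) (hs : TopologicalSpace.IsSeparable F) : MeasurableSet F := by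
  obtain ⟨D, hDF, hD, hFD⟩ := hs.exists_countable_dense_subset
  rw [← Subset.antisymm (hF.closure_subset_iff.2 hDF) hFD]
  exact UltraLimit.measurableSet_closure_of_countable hD

/-- Balls of `F` are traces of balls of X_ω and form a basis. Second countability makes the Borel
σ-algebra of `F` the one generated by this basis. -/
theorem UltraLimit.borelSpace_of_isSeparable {F : Set (UltraLimit ω p)}
    (hs : TopologicalSpace.IsSeparable F) : BorelSpace F := by
  have := hs.secondCountableTopology
  refine ⟨le_antisymm ?_ ?_⟩
  · rw [Subtype.instMeasurableSpace, UltraLimit.instMeasurableSpace,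
      MeasurableSpace.comap_generateFrom]
    refine MeasurableSpace.generateFrom_le ?_
    rintro _ ⟨_, ⟨x, r, -, rfl⟩, rfl⟩
    exact MeasurableSpace.measurableSet_generateFrom
      (Metric.isOpen_ball.preimage continuous_subtype_val)
  · have hb : TopologicalSpace.IsTopologicalBasis
        {s : Set F | ∃ (x : F) (r : ℝ), s = Metric.ball x r} := by
      refine TopologicalSpace.isTopologicalBasis_of_isOpen_of_nhds ?_ fun x u hx hu => ?_
      · rintro _ ⟨x, r, rfl⟩
        exact Metric.isOpen_ball
      · obtain ⟨r, hr, h⟩ := Metric.isOpen_iff.1 hu x hx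
        exact ⟨_, ⟨x, r, rfl⟩, Metric.mem_ball_self hr, h⟩
    rw [hb.borel_eq_generateFrom]
    refine MeasurableSpace.generateFrom_le ?_
    rintro _ ⟨x, r, rfl⟩
    exact ⟨Metric.ball (x : UltraLimit ω p) r, UltraLimit.measurableSet_ball _ _, rfl⟩

end BallSigmaAlgebra

/-! ### The support: closedness, separability, null complement. -/

section Support

variable {Z : Type*} [MetricSpace Z] [MeasurableSpace Z] {μ : Measure Z}

theorem isClosed_spt : IsClosed (spt μ) := by
  refine isClosed_of_closure_subset fun x hx r hr => ?_
  obtain ⟨y, hy, hxy⟩ := Metric.mem_closure_iff.1 hx (r / 2) (half_pos hr)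
  refine (hy (r / 2) (half_pos hr)).trans_le (measure_mono (Metric.ball_subset_ball' ?_))
  rw [dist_comm] at hxy
  linarith

theorem isSeparable_spt (hb : ∀ (x : Z) (r : ℝ), MeasurableSet (Metric.ball x r)) (q : Z)
    (hfin : ∀ R : ℝ, μ (Metric.ball q R) ≠ ∞) : TopologicalSpace.IsSeparable (spt μ) := by
  have key (n : ℕ) : TopologicalSpace.IsSeparable (spt μ ∩ Metric.ball q n) := by
    suffices h : ∀ ε > 0, ∃ t : Set Z, t.Countable ∧
        spt μ ∩ Metric.ball q n ⊆ ⋃ x ∈ t, Metric.closedEBall x ε by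
      obtain ⟨t, -, ht, hst⟩ := EMetric.subset_countable_closure_of_almost_dense_set _ h
      exact ⟨t, ht, hst⟩
    intro ε hε
    obtain ⟨δ, hδ, hδε⟩ := ENNReal.lt_iff_exists_nnreal_btwn.1 hε
    have hδ' : (0 : ℝ) < δ := by exact_mod_cast hδ
    -- A maximal δ-separated set is a δ-net. Its δ/2-balls are disjoint, of positive measure, and
    -- contained in one ball of finite measure, so it is countable.
    obtain ⟨N, hN⟩ := zorn_subset
      {N : Set Z | N ⊆ spt μ ∩ Metric.ball q n ∧ Metric.IsSeparated δ N} fun c hc hchain =>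
        ⟨⋃₀ c, ⟨sUnion_subset fun s hs => (hc hs).1,
          (pairwise_sUnion hchain.directedOn).2 fun s hs => (hc hs).2⟩,
          fun s hs => subset_sUnion_of_mem hs⟩
    refine ⟨N, ?_, ?_⟩
    · have := Measure.countable_meas_pos_of_disjoint_of_meas_iUnion_ne_top μ
        (As := fun x : N => Metric.ball (x : Z) (δ / 2)) (fun x => hb _ _) ?_ ?_
      · rw [eq_univ_of_forall (s := {x : N | 0 < μ (Metric.ball (x : Z) (δ / 2))})
          fun x => (hN.prop.1 x.2).1 _ (half_pos hδ')] at this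
        exact countable_coe_iff.1 (countable_univ_iff.1 this)
      · intro x y hxy
        refine Metric.ball_disjoint_ball ?_
        have h1 : (δ : ℝ≥0∞) < edist (x : Z) y := hN.prop.2 x.2 y.2 (fun h => hxy (Subtype.ext h))
        rw [edist_nndist, ENNReal.coe_lt_coe, ← NNReal.coe_lt_coe, coe_nndist] at h1
        linarith
      · refine ne_top_of_le_ne_top (hfin (n + δ)) (measure_mono (iUnion_subset fun x => ?_))
        refine Metric.ball_subset_ball' ?_
        have := (hN.prop.1 x.2).2.out
        linarith
    · refine (Metric.isCover_iff_subset_iUnion_closedEBall.1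
        (Metric.IsCover.of_maximal_isSeparated hN)).trans ?_
      exact iUnion₂_mono fun x _ => Metric.closedEBall_subset_closedEBall hδε.le
  refine (TopologicalSpace.IsSeparable.iUnion key).mono fun x hx => ?_
  obtain ⟨n, hn⟩ := exists_nat_gt (dist x q)
  exact mem_iUnion.2 ⟨n, hx, hn⟩

/-- Lindelöf: countably many null balls cover the part of `S` off the support. This is where
separability of `S` enters. -/
theorem measure_diff_spt_eq_zero {S : Set Z} (hS : TopologicalSpace.IsSeparable S) :
    μ (S \ spt μ) = 0 := by
  have := (hS.mono (sdiff_subset (s := S) (t := spt μ))).secondCountableTopology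
  have hx : ∀ x ∈ S \ spt μ, ∃ r : ℝ, 0 < r ∧ μ (Metric.ball x r) = 0 := by
    intro x hx
    have := hx.2
    simp only [spt, mem_ofPred_eq, not_forall, not_lt, nonpos_iff_eq_zero, exists_prop] at this
    exact this
  choose! r hr hμ using hx
  obtain ⟨t, ht, hcover⟩ := TopologicalSpace.countable_cover_nhds
    (α := ↥(S \ spt μ)) (f := fun x => Subtype.val ⁻¹' Metric.ball (x : Z) (r x)) fun x =>
      (Metric.isOpen_ball.preimage continuous_subtype_val).mem_nhds
        (Metric.mem_ball_self (hr x x.2))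
  refine measure_mono_null (t := ⋃ x ∈ t, Metric.ball (x : Z) (r x)) (fun x hx => ?_)
    ((measure_biUnion_null_iff ht).2 fun x _ => hμ x x.2)
  have := hcover.ge (mem_univ ⟨x, hx⟩)
  obtain ⟨y, hy, hxy⟩ := mem_iUnion₂.1 this
  exact mem_iUnion₂.2 ⟨y, hy, hxy⟩

end Support

/-! ### Concentration of the ultralimit measure on Y. -/

section LimitSpace

variable {X : ℕ → Type u} [∀ i, MetricSpace (X i)] {ω : Ultrafilter ℕ} {p : ∀ i, X i}

theorem eventually_mem_ball {x : BddSeq ω p} {R : ℝ}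
    (h : UltraLimit.mk ω p x ∈ Metric.ball (UltraLimit.base ω p) R) :
    ∀ᶠ i in (ω : Filter ℕ), x.seq i ∈ Metric.ball (p i) R := by
  rw [Metric.mem_ball, ← UltraLimit.mk_base, UltraLimit.dist_mk] at h
  exact (x.tendsto_dist (BddSeq.base ω p)).eventually_lt_const h

end LimitSpace

section LimitSpace

variable {X : ℕ → Type u} [∀ i, MetricSpace (X i)] [∀ i, MeasurableSpace (X i)]
  {ω : Ultrafilter ℕ} {m : ∀ i, Measure (X i)} {p : ∀ i, X i}

theorem isClosed_limitSet : IsClosed (limitSet ω m p) := by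
  rw [limitSet, insert_eq]
  exact isClosed_singleton.union isClosed_spt

variable [∀ i, BorelSpace (X i)]

theorem ultraMeasure_apply {s : Set (UltraLimit ω p)} (hs : MeasurableSet s) :
    ultraMeasure ω p m s = loebMeasure ω p m (UltraLimit.mk ω p ⁻¹' s) :=
  Measure.map_apply (measurable_mk ω p) hs

theorem ultraMeasure_le_limUnder (hω : (ω : Filter ℕ) ≤ atTop) {A : ∀ i, Set (X i)}
    (hA : ∀ i, MeasurableSet (A i)) {R : ℝ} (hR : ∀ i, A i ⊆ Metric.ball (p i) R)
    {s : Set (UltraLimit ω p)} (hs : MeasurableSet s)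
    (h : UltraLimit.mk ω p ⁻¹' s ⊆ internal ω p A) :
    ultraMeasure ω p m s ≤ limUnder (ω : Filter ℕ) fun i => m i (A i) := by
  rw [ultraMeasure_apply hs, (tendsto_measure_of_subset_ball m hω hA hR).limUnder_eq]
  exact measure_mono h

theorem ultraMeasure_ball_ne_top (hω : (ω : Filter ℕ) ≤ atTop)
    (h : IsUniformlyBoundedlyFinite ω m p) (R : ℝ) :
    ultraMeasure ω p m (Metric.ball (UltraLimit.base ω p) R) ≠ ∞ := by
  rcases le_or_gt R 0 with hR | hR
  · simp [Metric.ball_eq_empty.2 hR]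
  obtain ⟨η, hη⟩ := h
  refine ne_top_of_le_ne_top (ENNReal.coe_ne_top (r := η R)) ((ultraMeasure_le_limUnder hω
    (fun i => measurableSet_ball) (fun i => le_rfl) (UltraLimit.measurableSet_ball _ _)
    fun x hx => eventually_mem_ball hx).trans ?_)
  exact le_of_tendsto (tendsto_limUnder_ennreal ω _) (hη R hR)

theorem isSeparable_limitSet (hω : (ω : Filter ℕ) ≤ atTop)
    (h : IsUniformlyBoundedlyFinite ω m p) : TopologicalSpace.IsSeparable (limitSet ω m p) := by
  rw [limitSet, insert_eq]
  exact (finite_singleton _).isSeparable.union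
    (isSeparable_spt UltraLimit.measurableSet_ball (UltraLimit.base ω p)
      (ultraMeasure_ball_ne_top hω h))

theorem measurableSet_limitSet (hω : (ω : Filter ℕ) ≤ atTop)
    (h : IsUniformlyBoundedlyFinite ω m p) : MeasurableSet (limitSet ω m p) :=
  UltraLimit.measurableSet_of_isClosed_of_isSeparable isClosed_limitSet
    (isSeparable_limitSet hω h)

/-- Only centres that stay bounded along ω define points of X_ω. The others can be dropped: a
bounded sequence that was `r`-close to such a centre for ω-almost every index would bound it. Closed
balls ensure that a point outside them has limit distance strictly above `r`, hence distance above
`r` at ω-almost every index. -/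
theorem exists_finite_measure_ball_diff_biUnion_le (hω : (ω : Filter ℕ) ≤ atTop)
    (h : IsAsymptoticallyBoundedlyTotallyBounded ω m p) {R r ε : ℝ} (hR : 0 < R) (hr : 0 < r)
    (hε : 0 < ε) :
    ∃ D : Set (UltraLimit ω p), D.Finite ∧ ultraMeasure ω p m
      (Metric.ball (UltraLimit.base ω p) R \ ⋃ x ∈ D, Metric.closedBall x r) ≤
        ENNReal.ofReal ε := by
  obtain ⟨M, x, hx⟩ := h.2 R r ε hR hr hε
  let b : Fin M → Prop := fun n =>
    ∃ C : ℝ, ∀ᶠ i in (ω : Filter ℕ), dist (x i n) (p i) ≤ C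
  let D : Set (UltraLimit ω p) :=
    range fun n : {n // b n} => UltraLimit.mk ω p ⟨fun i => x i n, n.2⟩
  have hD : D.Finite := finite_range _
  refine ⟨D, hD, le_trans (ultraMeasure_le_limUnder hω
    (A := fun i => Metric.ball (p i) R \ ⋃ n, Metric.ball (x i n) r)
    (fun i => measurableSet_ball.diff (MeasurableSet.iUnion fun n => measurableSet_ball))
    (fun i => sdiff_subset) ((UltraLimit.measurableSet_ball _ _).diff
      (MeasurableSet.biUnion hD.countable fun x _ => UltraLimit.measurableSet_closedBall _ _))
    fun y hy => ?_) (le_trans (le_of_tendsto_of_tendsto' (tendsto_limUnder_ennreal ω _)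
      (tendsto_limUnder_ennreal ω _) fun i => measure_mono
        (sdiff_subset_sdiff_left Metric.ball_subset_closedBall)) hx)⟩
  have hn (n : Fin M) : ∀ᶠ i in (ω : Filter ℕ), y.seq i ∉ Metric.ball (x i n) r := by
    by_cases hb : b n
    · have : r < dist y ⟨fun i => x i n, hb⟩ := by
        have := hy.2
        simp only [mem_iUnion, not_exists, Metric.mem_closedBall, not_le] at this
        have := this _ (mem_range_self (⟨n, hb⟩ : {n // b n}))
        rwa [UltraLimit.dist_mk] at this
      filter_upwards [(y.tendsto_dist _).eventually_const_lt this] with i hi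
      simpa using hi.le
    · refine Ultrafilter.eventually_not.2 fun hev => hb ?_
      obtain ⟨C, hC⟩ := y.bdd
      refine ⟨r + C, ?_⟩
      filter_upwards [hev, hC] with i h1 h2
      rw [Metric.mem_ball, dist_comm] at h1
      exact (dist_triangle _ _ _).trans (add_le_add h1.le h2)
  filter_upwards [eventually_mem_ball hy.1, eventually_all.2 hn] with i h1 h2
  exact ⟨h1, by simpa only [mem_iUnion, not_exists] using h2⟩

theorem ultraMeasure_compl_limitSet (hω : (ω : Filter ℕ) ≤ atTop)
    (h : IsAsymptoticallyBoundedlyTotallyBounded ω m p) :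
    ultraMeasure ω p m (limitSet ω m p)ᶜ = 0 := by
  have hpos (n : ℕ) : (0 : ℝ) < 1 / ((n : ℝ) + 1) := by positivity
  choose D hD hDμ using fun R n : ℕ => exists_finite_measure_ball_diff_biUnion_le hω h
    (R := (R : ℝ) + 1) (by positivity) (hpos n) (hpos n)
  let S : Set (UltraLimit ω p) := ⋃ R, ⋃ n, D R n
  have hS : S.Countable := countable_iUnion fun R => countable_iUnion fun n => (hD R n).countable
  -- A point at distance at least ε from all centres is uncovered at every scale `1/(n+1) < ε`, and
  -- the uncovered sets have measure tending to zero.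
  have key (R k : ℕ) : ultraMeasure ω p m (⋂ n ∈ Ici k,
      Metric.ball (UltraLimit.base ω p) ((R : ℝ) + 1) \ ⋃ x ∈ D R n,
        Metric.closedBall x (1 / ((n : ℝ) + 1))) = 0 := by
    have hlim : Tendsto (fun n : ℕ => ENNReal.ofReal (1 / ((n : ℝ) + 1))) atTop (𝓝 0) := by
      rw [← ENNReal.ofReal_zero]
      exact ENNReal.tendsto_ofReal tendsto_one_div_add_atTop_nhds_zero_nat
    refine le_antisymm (ge_of_tendsto hlim ?_) zero_le
    filter_upwards [eventually_ge_atTop k] with n hn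
    exact (measure_mono (biInter_subset_of_mem (mem_Ici.2 hn))).trans (hDμ R n)
  have hcompl : ultraMeasure ω p m (closure S)ᶜ = 0 := by
    refine measure_mono_null (fun y hy => ?_)
      (measure_iUnion_null fun R => measure_iUnion_null fun k => key R k)
    obtain ⟨R, hR⟩ := exists_nat_gt (dist y (UltraLimit.base ω p))
    rw [mem_compl_iff, Metric.mem_closure_iff] at hy
    push Not at hy
    obtain ⟨ε, hε, hy⟩ := hy
    obtain ⟨k, hk⟩ := exists_nat_one_div_lt hε
    refine mem_iUnion.2 ⟨R, mem_iUnion.2 ⟨k, mem_iInter₂.2 fun n hn =>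
      ⟨Metric.mem_ball.2 (by linarith), fun hmem => ?_⟩⟩⟩
    obtain ⟨x, hx, hxy⟩ := mem_iUnion₂.1 hmem
    have h1 := hy x (mem_iUnion.2 ⟨R, mem_iUnion.2 ⟨n, hx⟩⟩)
    have h2 := Metric.mem_closedBall.1 hxy
    have h3 : 1 / ((n : ℝ) + 1) ≤ 1 / ((k : ℝ) + 1) :=
      one_div_le_one_div_of_le (by positivity) (by
        have : (k : ℝ) ≤ n := by exact_mod_cast hn
        linarith)
    linarith
  refine measure_mono_null (t := (closure S)ᶜ ∪ closure S \ spt (ultraMeasure ω p m))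
    (fun y hy => ?_) (measure_union_null hcompl
      (measure_diff_spt_eq_zero hS.isSeparable.closure))
  by_cases hyS : y ∈ closure S
  · exact Or.inr ⟨hyS, fun h => hy (mem_insert_of_mem _ h)⟩
  · exact Or.inl hyS

variable (ω m p) in
open Classical in
/-- The projection from bounded sequences to `spt(m_ω) ∪ {p_ω}`; sequences whose class lies
outside of this set are sent to the base point. -/
noncomputable def toLimitSet (x : BddSeq ω p) : limitSet ω m p :=
  if h : UltraLimit.mk ω p x ∈ limitSet ω m p then ⟨UltraLimit.mk ω p x, h⟩
  else limitBase ω m p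

theorem measurable_toLimitSet (hω : (ω : Filter ℕ) ≤ atTop)
    (h : IsUniformlyBoundedlyFinite ω m p) : Measurable (toLimitSet ω m p) := by
  classical
  exact Measurable.dite (s := {x | UltraLimit.mk ω p x ∈ limitSet ω m p})
    (f := fun x => (⟨UltraLimit.mk ω p x, x.2⟩ : limitSet ω m p)) (g := fun _ => limitBase ω m p)
    (((measurable_mk ω p).comp measurable_subtype_coe).subtype_mk) measurable_const
    (measurable_mk ω p (measurableSet_limitSet hω h))

theorem ae_coe_toLimitSet (hω : (ω : Filter ℕ) ≤ atTop)
    (h : IsAsymptoticallyBoundedlyTotallyBounded ω m p) :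
    ∀ᵐ x ∂(loebMeasure ω p m), (toLimitSet ω m p x : UltraLimit ω p) = UltraLimit.mk ω p x := by
  have := ultraMeasure_compl_limitSet hω h
  rw [ultraMeasure_apply (measurableSet_limitSet hω h.1).compl] at this
  filter_upwards [measure_eq_zero_iff_ae_notMem.1 this] with x hx
  simp only [mem_preimage, mem_compl_iff, not_not] at hx
  simp [toLimitSet, hx]

/-- Turns integrals over Y into integrals over bounded sequences, where the approximating maps are
defined. -/
theorem limitMeasure_eq_map (hω : (ω : Filter ℕ) ≤ atTop)
    (h : IsAsymptoticallyBoundedlyTotallyBounded ω m p) :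
    limitMeasure ω m p = (loebMeasure ω p m).map (toLimitSet ω m p) := by
  have hY := measurableSet_limitSet hω h.1
  ext s hs
  rw [Measure.map_apply (measurable_toLimitSet hω h.1) hs, limitMeasure,
    (MeasurableEmbedding.subtype_coe hY).comap_apply,
    ultraMeasure_apply ((MeasurableEmbedding.subtype_coe hY).measurableSet_image.2 hs)]
  refine measure_congr ?_
  filter_upwards [ae_coe_toLimitSet hω h] with x hx
  refine propext ?_
  change UltraLimit.mk ω p x ∈ Subtype.val '' s ↔ toLimitSet ω m p x ∈ s
  rw [← hx, Subtype.val_injective.mem_set_image]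

end LimitSpace

/-! ### Finite-valued approximations from nearest-centre indices. -/

section CoverIndex

variable {X : Type u} [MetricSpace X]

open Classical in
/-- The least `j < M` such that `a` lies in the ball `B(x_j, r)`, and `M` if there is none. -/
noncomputable def coverIndex (x : ℕ → X) (M : ℕ) (r : ℝ) (a : X) : ℕ :=
  Nat.find (⟨M, Or.inl le_rfl⟩ : ∃ j, M ≤ j ∨ dist a (x j) < r)

variable {x : ℕ → X} {M : ℕ} {r : ℝ} {a : X}

theorem coverIndex_le : coverIndex x M r a ≤ M :=
  Nat.find_min' _ (Or.inl le_rfl)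

theorem dist_lt_of_coverIndex_lt (h : coverIndex x M r a < M) :
    dist a (x (coverIndex x M r a)) < r := by
  classical
  exact (Nat.find_spec (⟨M, Or.inl le_rfl⟩ : ∃ j, M ≤ j ∨ dist a (x j) < r)).resolve_left
    (not_le.2 h)

theorem coverIndex_le_of_dist_lt {j : ℕ} (h : dist a (x j) < r) : coverIndex x M r a ≤ j :=
  Nat.find_min' _ (Or.inr h)

theorem measurable_coverIndex [MeasurableSpace X] [BorelSpace X] :
    Measurable (coverIndex x M r) := by
  classical
  refine measurable_find (p := fun a j => M ≤ j ∨ dist a (x j) < r) (fun a => ⟨M, Or.inl le_rfl⟩)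
    fun k => ?_
  exact (MeasurableSet.const (M ≤ k)).union measurableSet_ball

/-- The good set consists of the points with index below `M`. Replacing two points by their centres
costs less than `2 * r`, and passing from the `x j` to the `z j` costs at most `r`. Since `x 0 = p`
and the least index is taken, the base point goes exactly to `q`. -/
theorem isWeakApproximation_coverIndex [MeasurableSpace X] [BorelSpace X] {Y : Type v}
    [MetricSpace Y] [MeasurableSpace Y] {μ : Measure X} {ν : Measure Y} {p : X} {q : Y}
    {R : ℝ} {z : ℕ → Y} (hr : 0 < r) (hR : 3 * r < R) (hM : 0 < M) (hx : x 0 = p) (hz : z 0 = q)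
    (hdist : ∀ i < M, ∀ j < M, |dist (x i) (x j) - dist (z i) (z j)| ≤ r)
    (hμ : μ (Metric.ball p R ∩ coverIndex x M r ⁻¹' {M}) ≤ ENNReal.ofReal (3 * r))
    (hν : ν (Metric.ball q (R - 3 * r) \ ⋃ j ∈ Iio M, Metric.ball (z j) r) ≤
      ENNReal.ofReal (3 * r)) :
    IsWeakApproximation μ ν p q R (3 * r)
      (fun a : Metric.ball p R => z (coverIndex x M r (a : X))) := by
  have hp : coverIndex x M r p = 0 :=
    Nat.le_zero.1 (coverIndex_le_of_dist_lt (by rw [hx, dist_self]; exact hr))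
  refine ⟨by linarith, hR, (measurable_of_countable z).comp
    (measurable_coverIndex.comp measurable_subtype_coe), fun a ha => by rw [ha, hp, hz],
    {a | coverIndex x M r (a : X) < M}, ?_, ?_, ?_, ?_, ?_⟩
  · exact measurable_subtype_coe (measurable_coverIndex measurableSet_Iio)
  · exact ⟨⟨p, Metric.mem_ball_self (by linarith)⟩, by simpa [hp] using hM, rfl⟩
  · intro a ha b hb
    have h1 := dist_lt_of_coverIndex_lt ha
    have h2 := dist_lt_of_coverIndex_lt hb
    have h3 := abs_le.1 (hdist _ ha _ hb)
    have h4 := dist_triangle4 (a : X) (x (coverIndex x M r a)) (x (coverIndex x M r b)) b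
    have h5 := dist_triangle4 (x (coverIndex x M r a)) (a : X) b (x (coverIndex x M r b))
    rw [dist_comm (x (coverIndex x M r b)) b] at h4
    rw [dist_comm (x (coverIndex x M r a)) a] at h5
    rw [Subtype.dist_eq]
    constructor <;> linarith
  · refine le_trans (measure_mono ?_) hμ
    refine fun a ha => ⟨ha.1, ?_⟩
    exact le_antisymm coverIndex_le (not_lt.1 fun h => ha.2 ⟨⟨a, ha.1⟩, h, rfl⟩)
  · refine le_trans (measure_mono ?_) hν
    refine fun a ha => ⟨ha.1, fun hmem => ha.2 ?_⟩
    obtain ⟨j, hj, haj⟩ := mem_iUnion₂.1 hmem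
    have haq := Metric.mem_ball.1 ha.1
    rw [Metric.mem_ball] at haj
    have h1 := abs_le.1 (hdist j hj 0 hM)
    rw [hx, hz] at h1
    have h2 := dist_triangle_left (z j) q a
    have hjR : x j ∈ Metric.ball p R := by
      rw [Metric.mem_ball]
      linarith
    -- An earlier ball may catch `x j`, so its image need not be `z j`; it is still within `2 * r`
    -- of `z j`, hence within `3 * r` of `a`.
    have hjl : coverIndex x M r (x j) < M :=
      (coverIndex_le_of_dist_lt (by rwa [dist_self])).trans_lt hj
    have h3 := dist_lt_of_coverIndex_lt hjl
    have h4 := abs_le.1 (hdist j hj _ hjl)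
    refine Metric.mem_thickening_iff.2 ⟨_, ⟨⟨x j, hjR⟩, hjl, rfl⟩, ?_⟩
    have h5 := dist_triangle a (z j) (z (coverIndex x M r (x j)))
    simp only
    linarith

end CoverIndex

theorem integral_comp_nat_eq_sum {α : Type*} [MeasurableSpace α] {μ : Measure α}
    [IsFiniteMeasure μ] {c : α → ℕ} (hc : Measurable c) {M : ℕ} (hM : ∀ a, c a ≤ M) (g : ℕ → ℝ) :
    ∫ a, g (c a) ∂μ = ∑ j ∈ Finset.range (M + 1), μ.real (c ⁻¹' {j}) * g j := by
  have h : (fun a => g (c a)) = fun a => ∑ j ∈ Finset.range (M + 1),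
      (c ⁻¹' {j}).indicator (fun _ => g j) a := by
    funext a
    rw [Finset.sum_eq_single (c a)]
    · simp
    · intro j _ hj
      exact indicator_of_notMem (fun h => hj h.symm) _
    · intro h
      exact absurd (Finset.mem_range.2 (Nat.lt_succ_of_le (hM a))) h
  rw [h, integral_finsetSum]
  · refine Finset.sum_congr rfl fun j _ => ?_
    rw [integral_indicator_const _ (hc (measurableSet_singleton j)), smul_eq_mul]
  · intro j _
    exact (integrable_const _).indicator (hc (measurableSet_singleton j))

/-! ### Indices of bounded sequences along the ultrafilter. -/

section UltraIndex

variable {X : ℕ → Type u} [∀ i, MetricSpace (X i)] {ω : Ultrafilter ℕ} {p : ∀ i, X i}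

/-- The limit along `ω` of the natural numbers `c_i(x_i)`. -/
noncomputable def ultraIndex (c : ∀ i, X i → ℕ) (x : BddSeq ω p) : ℕ :=
  sInf {j | ∀ᶠ i in (ω : Filter ℕ), c i (x.seq i) = j}

/-- Pigeonhole for ultrafilters: with finitely many possible values, exactly one is taken ω-almost
everywhere. -/
theorem eventually_eq_ultraIndex {c : ∀ i, X i → ℕ} {M : ℕ} (hM : ∀ i a, c i a ≤ M)
    (x : BddSeq ω p) : ∀ᶠ i in (ω : Filter ℕ), c i (x.seq i) = ultraIndex c x := by
  have : {j | ∀ᶠ i in (ω : Filter ℕ), c i (x.seq i) = j}.Nonempty := by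
    obtain ⟨j, -, hj⟩ := (Ultrafilter.eventually_exists_mem_iff (f := ω) (is := Set.Iic M)
      (finite_Iic M) (P := fun j i => c i (x.seq i) = j)).1
        (Eventually.of_forall fun i => ⟨_, hM i _, rfl⟩)
    exact ⟨j, hj⟩
  exact Nat.sInf_mem this

theorem ultraIndex_eq_iff {c : ∀ i, X i → ℕ} {M : ℕ} (hM : ∀ i a, c i a ≤ M)
    {x : BddSeq ω p} {j : ℕ} :
    ultraIndex c x = j ↔ ∀ᶠ i in (ω : Filter ℕ), c i (x.seq i) = j := by
  refine ⟨fun h => h ▸ eventually_eq_ultraIndex hM x, fun h => ?_⟩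
  obtain ⟨i, h1, h2⟩ := (h.and (eventually_eq_ultraIndex hM x)).exists
  exact h2.symm.trans h1

theorem ultraIndex_le {c : ∀ i, X i → ℕ} {M : ℕ} (hM : ∀ i a, c i a ≤ M) (x : BddSeq ω p) :
    ultraIndex c x ≤ M := by
  obtain ⟨i, hi⟩ := (eventually_eq_ultraIndex hM x).exists
  exact hi ▸ hM i _

theorem preimage_ultraIndex {c : ∀ i, X i → ℕ} {M : ℕ} (hM : ∀ i a, c i a ≤ M) (j : ℕ) :
    ultraIndex c ⁻¹' {j} = internal ω p fun i => c i ⁻¹' {j} := by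
  ext x
  exact ultraIndex_eq_iff hM

theorem measurable_ultraIndex [∀ i, MeasurableSpace (X i)] {c : ∀ i, X i → ℕ} {M : ℕ}
    (hM : ∀ i a, c i a ≤ M) (hc : ∀ i, Measurable (c i)) :
    Measurable (ultraIndex c : BddSeq ω p → ℕ) := by
  refine measurable_to_countable' fun j => ?_
  rw [preimage_ultraIndex hM]
  exact measurableSet_internal fun i => hc i (measurableSet_singleton j)

theorem internal_inter (A B : ∀ i, Set (X i)) :
    internal ω p (fun i => A i ∩ B i) = internal ω p A ∩ internal ω p B := by
  ext x
  exact eventually_and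

end UltraIndex

theorem isFiniteMeasure_comap_ball {X : Type u} [MetricSpace X] [MeasurableSpace X] [BorelSpace X]
    {μ : Measure X} {p : X} {R : ℝ} (h : μ (Metric.ball p R) ≠ ∞) :
    IsFiniteMeasure (μ.comap (Subtype.val : Metric.ball p R → X)) := by
  refine ⟨?_⟩
  rw [(MeasurableEmbedding.subtype_coe measurableSet_ball).comap_apply, image_univ,
    Subtype.range_coe]
  exact h.lt_top

theorem integrable_pushBall {X : Type u} {Y : Type v} [MetricSpace X] [MeasurableSpace X]
    [BorelSpace X] [MeasurableSpace Y] {μ : Measure X} {p : X} {R : ℝ}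
    (h : μ (Metric.ball p R) ≠ ∞) (ψ : Metric.ball p R → Y) {f : Y → ℝ} (hf : Measurable f)
    {C : ℝ} (hC : ∀ y, |f y| ≤ C) : Integrable f (pushBall μ p R ψ) := by
  have := isFiniteMeasure_comap_ball h
  rw [pushBall]
  exact Integrable.of_bound hf.aestronglyMeasurable C (Eventually.of_forall hC)

theorem integral_pushBall_comp_nat {X : Type u} {Y : Type v} [MetricSpace X] [MeasurableSpace X]
    [BorelSpace X] [MeasurableSpace Y] {μ : Measure X} {p : X} {R : ℝ}
    (h : μ (Metric.ball p R) ≠ ∞) {c : X → ℕ} (hc : Measurable c) {M : ℕ} (hM : ∀ a, c a ≤ M)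
    (z : ℕ → Y) {f : Y → ℝ} (hf : Measurable f) :
    ∫ y, f y ∂(pushBall μ p R fun a => z (c a)) =
      ∑ j ∈ Finset.range (M + 1), μ.real (Metric.ball p R ∩ c ⁻¹' {j}) * f (z j) := by
  have := isFiniteMeasure_comap_ball h
  have hc' : Measurable fun a : Metric.ball p R => c (a : X) := hc.comp measurable_subtype_coe
  have hz : Measurable fun a : Metric.ball p R => z (c a) := (measurable_of_countable z).comp hc'
  rw [pushBall, integral_map hz.aemeasurable
    hf.aestronglyMeasurable, integral_comp_nat_eq_sum hc' (fun a => hM _) fun j => f (z j)]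
  refine Finset.sum_congr rfl fun j _ => ?_
  rw [measureReal_def, measureReal_def,
    (MeasurableEmbedding.subtype_coe measurableSet_ball).comap_apply]
  congr 3
  rw [show (fun a : Metric.ball p R => c (a : X)) ⁻¹' {j} = Subtype.val ⁻¹' (c ⁻¹' {j}) from rfl,
    Subtype.image_preimage_coe]

/-! ### Approximations at a fixed scale. -/

section Level

variable {X : ℕ → Type u} [∀ i, MetricSpace (X i)] [∀ i, MeasurableSpace (X i)]
  [∀ i, BorelSpace (X i)] {ω : Ultrafilter ℕ} {m : ∀ i, Measure (X i)} {p : ∀ i, X i}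

theorem loebMeasure_internal_ball_ne_top (hω : (ω : Filter ℕ) ≤ atTop)
    (h : IsUniformlyBoundedlyFinite ω m p) {R : ℝ} (hR : 0 < R) :
    loebMeasure ω p m (internal ω p fun i => Metric.ball (p i) R) ≠ ∞ := by
  obtain ⟨η, hη⟩ := h
  exact ne_top_of_le_ne_top (ENNReal.coe_ne_top (r := η R))
    (le_of_tendsto (tendsto_measure_of_subset_ball m hω (fun i => measurableSet_ball)
      fun i => le_rfl) (hη R hR))

theorem exists_dense_seq_limitSet (hω : (ω : Filter ℕ) ≤ atTop)
    (h : IsUniformlyBoundedlyFinite ω m p) :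
    ∃ y : ℕ → BddSeq ω p, y 0 = BddSeq.base ω p ∧
      (∀ j, UltraLimit.mk ω p (y j) ∈ limitSet ω m p) ∧
      ∀ z ∈ limitSet ω m p, ∀ r > 0, ∃ j, dist z (UltraLimit.mk ω p (y j)) < r := by
  have := (isSeparable_limitSet hω h).separableSpace
  have : Nonempty (limitSet ω m p) := ⟨limitBase ω m p⟩
  choose u hu using fun j =>
    UltraLimit.mk_surjective (TopologicalSpace.denseSeq (limitSet ω m p) j : UltraLimit ω p)
  refine ⟨fun j => Nat.casesOn j (BddSeq.base ω p) u, rfl, fun j => ?_, fun z hz r hr => ?_⟩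
  · cases j with
    | zero => exact mem_insert _ _
    | succ j =>
      change UltraLimit.mk ω p (u j) ∈ _
      rw [hu]
      exact Subtype.coe_prop _
  · obtain ⟨j, hj⟩ := (TopologicalSpace.denseRange_denseSeq (limitSet ω m p)).exists_dist_lt
      ⟨z, hz⟩ hr
    refine ⟨j + 1, ?_⟩
    change dist z (UltraLimit.mk ω p (u j)) < r
    rw [hu]
    exact hj

/-- Continuity from above, as the balls cover Y and the rest is null. The ball around the base point
is closed because a sequence in the open balls `B(p_i, R)` may have its class on the sphere. -/
theorem exists_measure_ball_diff_biUnion_le (hω : (ω : Filter ℕ) ≤ atTop)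
    (h : IsAsymptoticallyBoundedlyTotallyBounded ω m p) {y : ℕ → UltraLimit ω p} {r : ℝ}
    (hy : ∀ z ∈ limitSet ω m p, ∃ j, dist z (y j) < r) (R : ℝ) {δ : ℝ} (hδ : 0 < δ) :
    ∃ M, 0 < M ∧ ultraMeasure ω p m (Metric.closedBall (UltraLimit.base ω p) R \
      ⋃ j ∈ Iio M, Metric.ball (y j) r) ≤ ENNReal.ofReal δ := by
  let s : ℕ → Set (UltraLimit ω p) := fun M =>
    Metric.closedBall (UltraLimit.base ω p) R \ ⋃ j ∈ Iio M, Metric.ball (y j) r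
  have hs : Tendsto (fun M => ultraMeasure ω p m (s M)) atTop (𝓝 0) := by
    have h0 : ultraMeasure ω p m (⋂ M, s M) = 0 := by
      refine measure_mono_null (t := (limitSet ω m p)ᶜ) (fun z hz hzY => ?_) (ultraMeasure_compl_limitSet hω h)
      obtain ⟨j, hj⟩ := hy z hzY
      exact (mem_iInter.1 hz (j + 1)).2 (mem_iUnion₂.2 ⟨j, Nat.lt_succ_self j, hj⟩)
    rw [← h0]
    refine tendsto_measure_iInter_atTop (fun M => ?_) (fun M M' hM => ?_) ⟨0, ?_⟩
    · exact ((UltraLimit.measurableSet_closedBall _ _).diff (MeasurableSet.biUnion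
        (to_countable _) fun j _ => UltraLimit.measurableSet_ball _ _)).nullMeasurableSet
    · exact sdiff_subset_sdiff_right (biUnion_subset_biUnion_left (Iio_subset_Iio hM))
    · refine ne_top_of_le_ne_top (ultraMeasure_ball_ne_top hω h.1 (R + 1)) (measure_mono ?_)
      exact sdiff_subset.trans (Metric.closedBall_subset_ball (by linarith))
  obtain ⟨M, h1, h2⟩ := ((hs.eventually_le_const (ENNReal.ofReal_pos.2 hδ)).and
    (eventually_gt_atTop 0)).exists
  exact ⟨M, h2, h1⟩

/-- Finite-valued weak approximations, with control on the push-forward measures that is uniform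
in the test function. -/
theorem exists_approximations (hω : (ω : Filter ℕ) ≤ atTop)
    (h : IsAsymptoticallyBoundedlyTotallyBounded ω m p) {R r δ : ℝ} (hr : 0 < r)
    (hR : 3 * r < R) (hδ : 0 < δ) (hδr : 2 * δ ≤ 3 * r) :
    ∃ (V : Set (BddSeq ω p)) (Ψ : BddSeq ω p → limitSet ω m p), MeasurableSet V ∧ Measurable Ψ ∧
      loebMeasure ω p m (internal ω p (fun i => Metric.ball (p i) R) \ V) ≤ ENNReal.ofReal δ ∧
      (∀ x ∈ V, dist (Ψ x : UltraLimit ω p) (UltraLimit.mk ω p x) ≤ r) ∧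
      ∀ᶠ k in (ω : Filter ℕ), ∃ ψ : Metric.ball (p k) R → limitSet ω m p,
        IsWeakApproximation (m k) (limitMeasure ω m p) (p k) (limitBase ω m p) R (3 * r) ψ ∧
        ∀ (f : limitSet ω m p → ℝ) (C : ℝ), Measurable f → (∀ y, |f y| ≤ C) →
          Integrable f (pushBall (m k) (p k) R ψ) ∧
          |∫ y, f y ∂(pushBall (m k) (p k) R ψ) - ∫ x in V, f (Ψ x) ∂(loebMeasure ω p m)| ≤
            2 * δ * C := by
  have hR0 : 0 < R := by linarith
  obtain ⟨y, hy0, hyY, hyd⟩ := exists_dense_seq_limitSet hω h.1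
  obtain ⟨M, hM0, hM⟩ := exists_measure_ball_diff_biUnion_le hω h
    (y := fun j => UltraLimit.mk ω p (y j)) (fun z hz => hyd z hz r hr) R hδ
  let z : ℕ → limitSet ω m p := fun j => ⟨UltraLimit.mk ω p (y j), hyY j⟩
  have hz0 : z 0 = limitBase ω m p := Subtype.ext (by simp only [z, hy0]; rfl)
  let c : ∀ i, X i → ℕ := fun i => coverIndex (fun j => (y j).seq i) M r
  have hcM : ∀ i a, c i a ≤ M := fun i a => coverIndex_le
  have hc : ∀ i, Measurable (c i) := fun i => measurable_coverIndex
  let U : Set (BddSeq ω p) := internal ω p fun i => Metric.ball (p i) R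
  have hU : MeasurableSet U := measurableSet_internal fun i => measurableSet_ball
  have hUfin : loebMeasure ω p m U ≠ ∞ := loebMeasure_internal_ball_ne_top hω h.1 hR0
  have hcm : Measurable (ultraIndex c : BddSeq ω p → ℕ) := measurable_ultraIndex hcM hc
  let V : Set (BddSeq ω p) := U ∩ ultraIndex c ⁻¹' Iio M
  have hV : MeasurableSet V := hU.inter (hcm measurableSet_Iio)
  -- Uncovered points have index `M` and land on the irrelevant point `z M`; restricting to `V`
  -- removes them on the limit side.
  let Ψ : BddSeq ω p → limitSet ω m p := fun x => z (ultraIndex c x)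
  have hΨ : Measurable Ψ := (measurable_of_countable z).comp hcm
  have hrest : loebMeasure ω p m (U ∩ ultraIndex c ⁻¹' {M}) ≤ ENNReal.ofReal δ := by
    refine le_trans ?_ hM
    rw [ultraMeasure_apply ((UltraLimit.measurableSet_closedBall _ _).diff (MeasurableSet.biUnion
        (to_countable _) fun j _ => UltraLimit.measurableSet_ball _ _))]
    refine measure_mono fun x hx => ⟨?_, fun hmem => ?_⟩
    · rw [Metric.mem_closedBall, ← UltraLimit.mk_base, UltraLimit.dist_mk]
      exact le_of_tendsto (x.tendsto_dist _) (hx.1.mono fun i hi => le_of_lt hi)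
    · obtain ⟨j, hj, hxj⟩ := mem_iUnion₂.1 hmem
      rw [Metric.mem_ball, UltraLimit.dist_mk] at hxj
      obtain ⟨i, h1, h2⟩ := ((ultraIndex_eq_iff hcM).1 hx.2 |>.and
        ((x.tendsto_dist _).eventually_lt_const hxj)).exists
      exact absurd (coverIndex_le_of_dist_lt (x := fun j => (y j).seq i) (M := M) h2)
        (not_le.2 (lt_of_lt_of_eq hj h1.symm))
  have hUV : U \ V = U ∩ ultraIndex c ⁻¹' {M} := by
    ext x
    have := ultraIndex_le hcM x
    simp only [V, Set.mem_sdiff, mem_inter_iff, mem_preimage, mem_Iio, mem_singleton_iff, not_and,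
      not_lt]
    exact and_congr_right fun hx => ⟨fun h => le_antisymm this (h hx), fun h _ => h.ge⟩
  refine ⟨V, Ψ, hV, hΨ, ?_, fun x hx => ?_, ?_⟩
  · exact (congrArg _ hUV).trans_le hrest
  · change dist (UltraLimit.mk ω p (y (ultraIndex c x))) (UltraLimit.mk ω p x) ≤ r
    rw [dist_comm, UltraLimit.dist_mk]
    refine le_of_tendsto (x.tendsto_dist _) ((eventually_eq_ultraIndex hcM x).mono fun i hi => ?_)
    have hlt : c i (x.seq i) < M := hi.trans_lt hx.2
    rw [← hi]
    exact (dist_lt_of_coverIndex_lt hlt).le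
  let a : ℕ → ℝ := fun j => (loebMeasure ω p m).real (U ∩ ultraIndex c ⁻¹' {j})
  let b : ℕ → ℝ := fun j => if j < M then a j else 0
  let A : ℕ → ℕ → ℝ := fun k j => (m k).real (Metric.ball (p k) R ∩ c k ⁻¹' {j})
  have hlimA (j : ℕ) : Tendsto (fun k => A k j) (ω : Filter ℕ) (𝓝 (a j)) := by
    refine (ENNReal.tendsto_toReal (ne_top_of_le_ne_top hUfin
      (measure_mono inter_subset_left))).comp ?_
    rw [preimage_ultraIndex hcM, ← internal_inter]
    exact tendsto_measure_of_subset_ball m hω (fun i => measurableSet_ball.inter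
      (hc i (measurableSet_singleton j))) fun i => inter_subset_left
  have hsum : ∑ j ∈ Finset.range (M + 1), |a j - b j| ≤ δ := by
    rw [Finset.sum_range_succ, Finset.sum_eq_zero, zero_add]
    · simp only [b, lt_irrefl, if_false, sub_zero, a, abs_of_nonneg measureReal_nonneg]
      exact ENNReal.toReal_le_of_le_ofReal hδ.le hrest
    · intro j hj
      simp [b, Finset.mem_range.1 hj]
  -- This ℓ¹ distance of masses tends to `a M ≤ δ`, so it is eventually below `2 * δ`. It bounds the
  -- integral error for all `f` at once, and its term `j = M`, where `b M = 0`, bounds the uncovered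
  -- mass.
  have hlim : Tendsto (fun k => ∑ j ∈ Finset.range (M + 1), |A k j - b j|) (ω : Filter ℕ)
      (𝓝 (∑ j ∈ Finset.range (M + 1), |a j - b j|)) :=
    tendsto_finsetSum _ fun j _ => ((hlimA j).sub_const _).abs
  have hint (f : limitSet ω m p → ℝ) : ∫ x in V, f (Ψ x) ∂(loebMeasure ω p m) =
      ∑ j ∈ Finset.range (M + 1), b j * f (z j) := by
    have : IsFiniteMeasure ((loebMeasure ω p m).restrict V) :=
      ⟨by
        rw [Measure.restrict_apply_univ]
        exact (measure_mono inter_subset_left).trans_lt hUfin.lt_top⟩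
    rw [integral_comp_nat_eq_sum hcm (ultraIndex_le hcM) fun j => f (z j)]
    refine Finset.sum_congr rfl fun j _ => ?_
    rw [measureReal_restrict_apply (hcm (measurableSet_singleton j))]
    simp only [b, a]
    split_ifs with hj
    · congr 2
      ext x
      simp only [V, mem_inter_iff, mem_preimage, mem_singleton_iff, mem_Iio]
      exact ⟨fun h => ⟨h.2.1, h.1⟩, fun h => ⟨h.2, h.1, h.2.trans_lt hj⟩⟩
    · rw [eq_empty_of_forall_notMem (s := ultraIndex c ⁻¹' {j} ∩ V), measureReal_empty]
      exact fun x hx => hj (hx.1.symm.trans_lt hx.2.2)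
  have hdist : ∀ᶠ k in (ω : Filter ℕ), ∀ i < M, ∀ j < M,
      |dist ((y i).seq k) ((y j).seq k) - dist (z i) (z j)| ≤ r := by
    refine (eventually_all_finite (finite_Iio M)).2 fun i _ =>
      (eventually_all_finite (finite_Iio M)).2 fun j _ => ?_
    have := (((y i).tendsto_dist (y j)).sub_const (dist (y i) (y j))).abs
    rw [sub_self, abs_zero] at this
    filter_upwards [this.eventually_le_const hr] with k hk
    rwa [Subtype.dist_eq, UltraLimit.dist_mk]
  have hfin : ∀ᶠ k in (ω : Filter ℕ), m k (Metric.ball (p k) R) ≠ ∞ := by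
    obtain ⟨η, hη⟩ := h.1
    exact (hη R hR0).mono fun k hk => ne_top_of_le_ne_top ENNReal.coe_ne_top hk
  filter_upwards [hlim.eventually_lt_const (hsum.trans_lt (by linarith : δ < 2 * δ)), hdist, hfin]
    with k hk hdk hfk
  refine ⟨fun a => z (c k a), isWeakApproximation_coverIndex hr hR hM0 ?_ hz0 hdk ?_ ?_,
    fun f C hf hC => ⟨integrable_pushBall hfk _ hf hC, ?_⟩⟩
  · simp only [hy0]; rfl
  · refine (ENNReal.le_ofReal_iff_toReal_le (ne_top_of_le_ne_top hfk
      (measure_mono inter_subset_left)) (by linarith)).2 ?_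
    have := (Finset.single_le_sum (f := fun j => |A k j - b j|) (fun j _ => abs_nonneg _)
      (Finset.self_mem_range_succ M)).trans hk.le
    simp only [b, lt_irrefl, if_false, sub_zero, A, abs_of_nonneg measureReal_nonneg] at this
    exact this.trans hδr
  · rw [limitMeasure, (MeasurableEmbedding.subtype_coe (measurableSet_limitSet hω h.1)).comap_apply]
    refine le_trans (measure_mono ?_) (hM.trans (ENNReal.ofReal_le_ofReal (by linarith)))
    rintro _ ⟨x, hx, rfl⟩
    refine ⟨?_, fun hmem => hx.2 ?_⟩
    · exact Metric.ball_subset_closedBall (Metric.ball_subset_ball (by linarith) hx.1)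
    · obtain ⟨j, hj, hxj⟩ := mem_iUnion₂.1 hmem
      exact mem_iUnion₂.2 ⟨j, hj, hxj⟩
  · rw [integral_pushBall_comp_nat hfk (hc k) (hcM k) z hf, hint, ← Finset.sum_sub_distrib]
    have hC0 : 0 ≤ C := (abs_nonneg _).trans (hC (limitBase ω m p))
    refine (Finset.abs_sum_le_sum_abs _ _).trans
      (le_trans ?_ (mul_le_mul_of_nonneg_right hk.le hC0))
    rw [Finset.sum_mul]
    refine Finset.sum_le_sum fun j _ => ?_
    rw [← sub_mul, abs_mul]
    exact mul_le_mul_of_nonneg_left (hC _) (abs_nonneg _)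

end Level

/-! ### Passage to the limit over the scales. -/

theorem WeaklyTendsto.of_approximate_integrals {Y : Type v} [MetricSpace Y] [MeasurableSpace Y]
    [BorelSpace Y] {l : Filter ℕ} {N : ℕ → ℕ} (hN : Tendsto N l atTop) {μ : ℕ → Measure Y}
    {ν : Measure Y} {I : ℕ → (Y → ℝ) → ℝ} {δ : ℕ → ℝ} (hδ : Tendsto δ atTop (𝓝 0))
    (hμ : ∀ᶠ k in l, ∀ (f : Y → ℝ) (C : ℝ), Measurable f → (∀ y, |f y| ≤ C) →
      Integrable f (μ k) ∧ |∫ y, f y ∂(μ k) - I (N k) f| ≤ δ (N k) * C)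
    (hI : ∀ (f : Y → ℝ) (C : ℝ), Continuous f → (∀ y, |f y| ≤ C) →
      Bornology.IsBounded (tsupport f) →
        Integrable f ν ∧ Tendsto (fun n => I n f) atTop (𝓝 (∫ y, f y ∂ν))) :
    WeaklyTendsto l μ ν := by
  rintro f hf ⟨C, hC⟩ hfb
  obtain ⟨h1, h2⟩ := hI f C hf hC hfb
  refine ⟨h1, hμ.mono fun k hk => (hk f C hf.measurable hC).1, ?_⟩
  have h3 : Tendsto (fun k => ∫ y, f y ∂(μ k) - I (N k) f) l (𝓝 0) := by
    refine squeeze_zero_norm' (hμ.mono fun k hk => (hk f C hf.measurable hC).2) ?_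
    simpa using (hδ.comp hN).mul_const C
  simpa using h3.add (h2.comp hN)

section Main

variable {X : ℕ → Type u} [∀ i, MetricSpace (X i)] [∀ i, MeasurableSpace (X i)]
  [∀ i, BorelSpace (X i)] {ω : Ultrafilter ℕ} {m : ∀ i, Measure (X i)} {p : ∀ i, X i}

/-- By Borel–Cantelli almost every sequence lies in `V n` for all large `n`, where `Ψ n` converges
to its class; dominated convergence then applies. -/
theorem tendsto_setIntegral_approximations (hω : (ω : Filter ℕ) ≤ atTop)
    (h : IsAsymptoticallyBoundedlyTotallyBounded ω m p) {R r : ℕ → ℝ} {δ : ℕ → ℝ≥0∞}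
    (hR : Tendsto R atTop atTop) (hr : Tendsto r atTop (𝓝 0)) (hr1 : ∀ n, r n < 1)
    (hδ : ∑' n, δ n ≠ ∞) {V : ℕ → Set (BddSeq ω p)} {Ψ : ℕ → BddSeq ω p → limitSet ω m p}
    (hV : ∀ n, MeasurableSet (V n)) (hΨ : ∀ n, Measurable (Ψ n))
    (hVδ : ∀ n, loebMeasure ω p m (internal ω p (fun i => Metric.ball (p i) (R n)) \ V n) ≤ δ n)
    (hd : ∀ n, ∀ x ∈ V n, dist (Ψ n x : UltraLimit ω p) (UltraLimit.mk ω p x) ≤ r n)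
    {f : limitSet ω m p → ℝ} {C : ℝ} (hf : Continuous f) (hC : ∀ y, |f y| ≤ C)
    (hfb : Bornology.IsBounded (tsupport f)) :
    Integrable f (limitMeasure ω m p) ∧
      Tendsto (fun n => ∫ x in V n, f (Ψ n x) ∂(loebMeasure ω p m)) atTop
        (𝓝 (∫ y, f y ∂(limitMeasure ω m p))) := by
  have := UltraLimit.borelSpace_of_isSeparable (isSeparable_limitSet hω h.1)
  have hπ := measurable_toLimitSet hω h.1
  have hfm := hf.measurable
  have hC0 : 0 ≤ C := (abs_nonneg _).trans (hC (limitBase ω m p))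
  obtain ⟨S, hS⟩ := hfb.subset_ball (limitBase ω m p)
  -- `Ψ n` moves classes by less than 1, so all integrands vanish outside the ball of radius `S +
  -- 1`; there `C` dominates.
  let B : Set (BddSeq ω p) :=
    UltraLimit.mk ω p ⁻¹' Metric.ball (UltraLimit.base ω p) (S + 1)
  have hBm : MeasurableSet B := measurable_mk ω p (UltraLimit.measurableSet_ball _ _)
  have hBfin : loebMeasure ω p m B ≠ ∞ := by
    rw [← ultraMeasure_apply (UltraLimit.measurableSet_ball _ _)]
    exact ultraMeasure_ball_ne_top hω h.1 _
  have hg : Integrable (B.indicator fun _ => C) (loebMeasure ω p m) :=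
    (integrable_indicator_iff hBm).2 (integrableOn_const hBfin)
  have hbound (x : BddSeq ω p) (y : limitSet ω m p)
      (hxy : dist (y : UltraLimit ω p) (UltraLimit.mk ω p x) < 1) :
      ‖f y‖ ≤ B.indicator (fun _ => C) x := by
    by_cases hx : x ∈ B
    · rw [indicator_of_mem hx]
      exact hC y
    · rw [indicator_of_notMem hx, norm_le_zero_iff]
      refine image_eq_zero_of_notMem_tsupport fun hy => ?_
      have h1 : dist (y : UltraLimit ω p) (UltraLimit.base ω p) < S := hS hy
      exact hx ((dist_triangle_left _ _ (y : UltraLimit ω p)).trans_lt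
        (by rw [add_comm S]; exact add_lt_add hxy h1))
  have hae := ae_coe_toLimitSet hω h
  have hint : Integrable (fun x => f (toLimitSet ω m p x)) (loebMeasure ω p m) := by
    refine hg.mono' (hfm.comp hπ).aestronglyMeasurable ?_
    filter_upwards [hae] with x hx
    exact hbound x _ (by rw [hx, dist_self]; exact one_pos)
  rw [limitMeasure_eq_map hω h]
  refine ⟨(integrable_map_measure hfm.aestronglyMeasurable hπ.aemeasurable).2 hint, ?_⟩
  rw [integral_map hπ.aemeasurable hfm.aestronglyMeasurable]
  simp_rw [← integral_indicator (hV _)]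
  refine tendsto_integral_of_dominated_convergence (B.indicator fun _ => C)
    (fun n => ((hfm.comp (hΨ n)).indicator (hV n)).aestronglyMeasurable) hg (fun n => ?_) ?_
  · refine Eventually.of_forall fun x => ?_
    by_cases hx : x ∈ V n
    · rw [indicator_of_mem hx]
      exact hbound x _ ((hd n x hx).trans_lt (hr1 n))
    · rw [indicator_of_notMem hx, norm_zero]
      exact indicator_nonneg (fun _ _ => hC0) x
  · filter_upwards [hae, ae_eventually_notMem (ne_top_of_le_ne_top hδ (ENNReal.tsum_le_tsum hVδ))]
      with x hx hxn
    have hxV : ∀ᶠ n in atTop, x ∈ V n := by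
      filter_upwards [hxn, hR.eventually_gt_atTop
        (dist (UltraLimit.mk ω p x) (UltraLimit.base ω p))] with n h1 h2
      by_contra h3
      exact h1 ⟨eventually_mem_ball h2, h3⟩
    have hlim : Tendsto (fun n => Ψ n x) atTop (𝓝 (toLimitSet ω m p x)) := by
      refine tendsto_iff_dist_tendsto_zero.2
        (squeeze_zero' (Eventually.of_forall fun _ => dist_nonneg) ?_ hr)
      filter_upwards [hxV] with n hn
      rw [Subtype.dist_eq, hx]
      exact hd n x hn
    refine ((hf.tendsto _).comp hlim).congr' ?_
    filter_upwards [hxV] with n hn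
    rw [indicator_of_mem hn]
    rfl

theorem wpmghConverges_limitSet (hω : (ω : Filter ℕ) ≤ atTop)
    (h : IsAsymptoticallyBoundedlyTotallyBounded ω m p) :
    WPMGHConvergesAlong ω m p (limitMeasure ω m p) (limitBase ω m p) ∧
    ∃ k : ℕ → ℕ, StrictMono k ∧
      WPMGHConverges (fun j => m (k j)) (fun j => p (k j)) (limitMeasure ω m p)
        (limitBase ω m p) := by
  have := UltraLimit.borelSpace_of_isSeparable (isSeparable_limitSet hω h.1)
  let R : ℕ → ℝ := fun n => n + 2
  let ε : ℕ → ℝ := fun n => 1 / ((n : ℝ) + 1)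
  -- Summable for Borel–Cantelli, with `2 * δ n = 2⁻ⁿ ≤ ε n`.
  let δ : ℕ → ℝ := fun n => (1 / 2) ^ n * (1 / 2)
  have hε (n : ℕ) : 0 < ε n := by positivity
  have hε1 (n : ℕ) : ε n ≤ 1 := by
    refine (div_le_one (by positivity)).2 ?_
    linarith [(Nat.cast_nonneg n : (0 : ℝ) ≤ n)]
  have hε0 : Tendsto ε atTop (𝓝 0) := tendsto_one_div_add_atTop_nhds_zero_nat
  have hεanti : Antitone ε := fun a b hab =>
    one_div_le_one_div_of_le (by positivity) (by
      have : (a : ℝ) ≤ b := by exact_mod_cast hab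
      linarith)
  have hR : Tendsto R atTop atTop :=
    tendsto_atTop_add_const_right _ _ tendsto_natCast_atTop_atTop
  have hRmono : Monotone R := fun a b hab => by
    have : (a : ℝ) ≤ b := by exact_mod_cast hab
    simpa [R] using this
  have hδε (n : ℕ) : 2 * δ n ≤ ε n := by
    have h1 : (1 / 2 : ℝ) ^ n ≤ 1 / ((n : ℝ) + 1) := by
      rw [one_div_pow]
      refine one_div_le_one_div_of_le (by positivity) ?_
      exact_mod_cast Nat.lt_two_pow_self (n := n)
    simp only [δ, ε]
    linarith
  have hδsum : ∑' n, ENNReal.ofReal (δ n) ≠ ∞ :=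
    (summable_geometric_two.mul_right (1 / 2)).tsum_ofReal_ne_top
  choose V Ψ hV hΨ hVδ hd hE using fun n => exists_approximations hω h (R := R n) (r := ε n / 3)
    (δ := δ n) (by linarith [hε n]) (by
      have := hε1 n
      simp only [R]
      linarith [(Nat.cast_nonneg n : (0 : ℝ) ≤ n)]) (by positivity) (by linarith [hδε n])
  have h3 (n : ℕ) : 3 * (ε n / 3) = ε n := by ring
  simp only [h3] at hE
  let I : ℕ → (limitSet ω m p → ℝ) → ℝ := fun n f =>
    ∫ x in V n, f (Ψ n x) ∂(loebMeasure ω p m)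
  have hI (f : limitSet ω m p → ℝ) (C : ℝ) (hf : Continuous f) (hC : ∀ y, |f y| ≤ C)
      (hfb : Bornology.IsBounded (tsupport f)) :=
    tendsto_setIntegral_approximations hω h (r := fun n => ε n / 3) hR
      (by simpa using hε0.div_const 3) (fun n => by linarith [hε1 n]) hδsum hV hΨ hVδ hd hf hC hfb
  have hδ0 : Tendsto (fun n => 2 * δ n) atTop (𝓝 0) :=
    squeeze_zero (fun n => by positivity) hδε hε0
  refine ⟨?_, ?_⟩
  · obtain ⟨N, hN, hNE⟩ := exists_tendsto_diagonal hω hE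
    have : Nonempty (limitSet ω m p) := ⟨limitBase ω m p⟩
    obtain ⟨ψ, hψ⟩ := skolem.1 hNE
    refine ⟨fun k => R (N k), fun k => ε (N k), ψ, hψ.mono fun k hk => hk.1, hR.comp hN,
      hε0.comp hN, WeaklyTendsto.of_approximate_integrals hN hδ0
        (hψ.mono fun k hk => hk.2) hI⟩
  -- Each level is realised ω-almost everywhere, hence at infinitely many indices, so level `j` can
  -- be placed at some `k j` with `k` strictly increasing.
  · obtain ⟨k, hk, hkE⟩ := extraction_forall_of_frequently fun n => (hE n).frequently.filter_mono hω
    choose ψ hψ using hkE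
    exact ⟨k, hk, R, ε, ψ, fun j => (hψ j).1, ⟨hRmono, hR⟩, ⟨hεanti, hε0⟩,
      WeaklyTendsto.of_approximate_integrals tendsto_id hδ0
        (Eventually.of_forall fun j => (hψ j).2) hI⟩

end Main

end UltraMMS

theorem mainTheorem5 (ω : Ultrafilter ℕ) (hω : ∀ n : ℕ, ({n} : Set ℕ) ∉ ω)
    {X : ℕ → Type*} [∀ i, MetricSpace (X i)] [∀ i, CompleteSpace (X i)]
    [∀ i, TopologicalSpace.SeparableSpace (X i)]
    [∀ i, MeasurableSpace (X i)] [∀ i, BorelSpace (X i)]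
    (m : ∀ i, Measure (X i)) (p : ∀ i, X i)
    (h : UltraMMS.IsAsymptoticallyBoundedlyTotallyBounded ω m p) :
    (CompleteSpace (UltraMMS.limitSet ω m p) ∧
      TopologicalSpace.SeparableSpace (UltraMMS.limitSet ω m p) ∧
      BorelSpace (UltraMMS.limitSet ω m p)) ∧
    UltraMMS.WPMGHConvergesAlong ω m p (UltraMMS.limitMeasure ω m p)
      (UltraMMS.limitBase ω m p) ∧
    ∃ k : ℕ → ℕ, StrictMono k ∧
      UltraMMS.WPMGHConverges (fun j => m (k j)) (fun j => p (k j))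
        (UltraMMS.limitMeasure ω m p) (UltraMMS.limitBase ω m p) := by
  have hω' := UltraMMS.le_atTop_of_singleton_notMem hω
  have := UltraMMS.UltraLimit.completeSpace (p := p) hω'
  have hsep := UltraMMS.isSeparable_limitSet hω' h.1
  exact ⟨⟨UltraMMS.isClosed_limitSet.completeSpace_coe, hsep.separableSpace,
    UltraMMS.UltraLimit.borelSpace_of_isSeparable hsep⟩, UltraMMS.wpmghConverges_limitSet hω' h⟩
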